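/- **Setting.** All quantities are in a timescale $\tau$ with $d\tau/dt=\epsilon$, $|\cdot|$ is the Euclidean norm, and $N$ is a real parameter. Let $D_r\subset\mathbb R^{n_r}$ and let $\xi_r$ solve $\frac{d\xi_r}{d\tau}=A_r(N)\xi_r$. For $x=(\xi_o,\xi_c,\xi_{zo},\xi_{zc})$ put $p=C_o\xi_o$, $$h(x,\xi_r)=C_o\xi_o-C_r\xi_r\in\mathbb R^2,\qquad h_z(x)=C_{zo}\xi_{zo}+f_s(C_o\xi_o)\in\mathbb R,$$ and let $f(x,\xi_r,\epsilon,N)$ be $\frac1\epsilon$ times the vector with blocks $A_o\xi_o+B_oC_c(\epsilon,N)\xi_c$, $\ A_c(\epsilon,N)\xi_c+B_c(\epsilon,N)h(x,\xi_r)$, $\ A_{zo}\xi_{zo}+B_{zo}C_{zc}\xi_{zc}$, $\ A_{zc}\xi_{zc}+B_{zc}h_z(x)$; the plant is $\frac{dx}{d\tau}=f(x,\xi_r,\epsilon,N)$. Let $T_l>0$, $\tau_\phi\in[0,T_l]$, $p\in[1,\infty]$, let $g_e,g_s:\mathbb R\to\mathbb R$ be $C^1$, and let $L_e(e)(\tau)=\big(\frac1{T_l}\int_{\tau-T_l}^{\tau}|e(\sigma)|^pd\sigma\big)^{1/p}$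 (for $p=\infty$: $\max_{[\tau-T_l,\tau]}|e|$). Let $\overline\epsilon,\underline N>0$; for $N\ge\underline N$ the matrices $A_c,B_c,C_c$ are $C^1$ in $\epsilon\in(0,\overline\epsilon]$. **Assumptions** (constants and comparison functions do not depend on $\epsilon$, $N$, $\tau$, $\xi_r(0)$ unless said; $\epsilon\in(0,\overline\epsilon]$, $N\ge\underline N$, $\xi_r(0)\in D_r$ throughout). 1. For each $N$ the exosystem is neutrally stable ($e^{\tau A_r(N)}$ is bounded in $\tau\in\mathbb R$), and solutions starting in $D_r$ stay in $D_r$ for all $\tau\in\mathbb R$. 2. $f_s:\mathbb R^2\to\mathbb R$ is $C^1$. 3. There is a map $M(\xi_r,\epsilon,N)$, $C^1$ in $(\xi_r,\epsilon)\in D_r\times(0,\overline\epsilon]$, bounded on $D_r\times(0,\overline\epsilon]\times[\underline N,\infty)$, with $\partial M/\partial\epsilon$ bounded on $D_r\times[c,\overline\epsilon]\times[\underline N,\infty)$ for each $c>0$, such that for each constant $\epsilon$, $N$ and $\xi_r(0)$: $\bar x(\tau)=M(\xi_r(\tau),\epsilon,N)$ is a uniformly globally asymptotically stable solution of the plant;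 $h(\bar x(\tau),\xi_r(\tau))=0$ for all $\tau\in\mathbb R$; and $|h_z(\bar x(\tau+T_l))-h_z(\bar x(\tau))|\le k_e/N$ for all $\tau\in\mathbb R$ and some $k_e>0$. Moreover there are $\alpha_{x1},\alpha_{x2}\in\mathcal K_\infty$, $\alpha_f\in\mathcal K$ and a function $V_x(\tilde x,\epsilon,N)$, $C^1$ in $(\tilde x,\epsilon)$, with $\partial V_x/\partial\tilde x$ and $\partial V_x/\partial\epsilon$ bounded on $\{|\tilde x|\le R\}\times[c,\overline\epsilon]\times[\underline N,\infty)$ for all $R,c>0$, such that for all $\tilde x$ and $\tau\ge0$ $$\alpha_{x1}(|\tilde x|)\le V_x(\tilde x,\epsilon,N)\le\alpha_{x2}(|\tilde x|),\qquad \tfrac{\partial V_x}{\partial\tilde x}\tilde f(\tilde x,\xi_r(\tau),\epsilon,N)\le-\alpha_f(|\tilde x|),$$ where $\tilde f(\tilde x,\xi,\epsilon,N)=f(\tilde x+M(\xi,\epsilon,N),\xi,\epsilon,N)-f(M(\xi,\epsilon,N),\xi,\epsilon,N)$. 4. Let $\bar J(\epsilon,N,\tau)=g_e\big(L_e(h_z(M(\xi_r(\cdot),\epsilon,N)))(\tau)\big)+g_s(\epsilon)$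 (it depends on $\xi_r(0)$ too). It is twice differentiable in $\epsilon\in(0,\overline\epsilon]$; $\bar J$, $\partial\bar J/\partial\epsilon$, $\partial^2\bar J/\partial\epsilon^2$ are bounded; $\bar J(\cdot,N,\tau)$ has a maximum over $(0,\overline\epsilon]$ at $\epsilon^*(N,\tau)$ for all $\tau\in\mathbb R$; there is $\alpha_J\in\mathcal K$ with $\frac{\partial\bar J}{\partial\epsilon}(\epsilon,N,\tau)(\epsilon-\epsilon^*(N,\tau))\le-\alpha_J(|\epsilon-\epsilon^*(N,\tau)|)$; and there are $\underline{\epsilon^*},\overline{\epsilon^*}\in(0,\overline\epsilon)$ with $\underline{\epsilon^*}\le\epsilon^*(N,\tau)\le\overline{\epsilon^*}$ for all $N>\underline N$, $\tau\in\mathbb R$. 5. $\bar J$ and $\epsilon^*$ are $C^1$ in $\tau$, and $|\partial\bar J/\partial\tau|\le k_J/N$, $|\partial\epsilon^*/\partial\tau|\le k_\epsilon/N$ for some $k_J,k_\epsilon>0$. **Closed loop.** For $a,\omega,\delta>0$ let $\tilde\epsilon=\hat\epsilon-\epsilon^*(N,\tau)$, $\epsilon=\hat\epsilon+a\sin(\omega\tau)$,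 $\tau_d=T_l+\frac{2\pi}\omega$, $q(\tau)=g_e\big(L_e(h_z(\tilde x+M(\xi_r,\epsilon,N)))(\tau)\big)+g_s(\epsilon(\tau-\tau_\phi))$, and $$\tfrac{d\xi_r}{d\tau}=A_r(N)\xi_r,\qquad \tfrac{d\tilde x}{d\tau}=\tilde f(\tilde x,\xi_r,\epsilon,N)-\tfrac{\partial M}{\partial\epsilon}\big(\tfrac{d\hat\epsilon}{d\tau}+a\omega\cos(\omega\tau)\big),$$ $$\tfrac{d\tilde\epsilon}{d\tau}=\tfrac{d\hat\epsilon}{d\tau}-\tfrac{\partial\epsilon^*}{\partial\tau}(N,\tau),\qquad \tfrac{d\hat\epsilon}{d\tau}=\tfrac{a\omega^2\delta}{\pi}\int_{\tau-2\pi/\omega}^{\tau}q(\sigma)\sin(\omega(\sigma-\tau_\phi))\,d\sigma .$$ **Theorem 1.** Under Assumptions 1–5, for each $\rho_x^0,\rho_\epsilon^0>0$, each $\nu_\epsilon^+\in(0,\overline\epsilon/2)$ and each $\nu_x,\nu_\epsilon>0$ there exist $\rho_x,\rho_\epsilon>0$ and $a^*>0$ such that for each $a\in(0,a^*)$ there exists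 $\omega^*>0$ such that for each $\omega\in(0,\omega^*)$ there exists $\delta^*>0$ such that for each $\delta\in(0,\delta^*)$ there exists $N^*>0$ such that for each $N\in(N^*,\infty)$, each $\xi_r(0)\in D_r$ and all continuous initial histories $(\tilde x,\tilde\epsilon)$ on $[-\tau_d,0]$ with $|\tilde x|\le\rho_x^0$, $|\tilde\epsilon|\le\rho_\epsilon^0$ and $0<\epsilon\le\overline\epsilon$ on $[-\tau_d,0]$, and $\nu_\epsilon^+\le\hat\epsilon(0)\le\overline\epsilon-\nu_\epsilon^+$: the closed loop has a solution on $[0,\infty)$, and every such solution satisfies $$\sup_{\tau\ge0}|\tilde x(\tau)|\le\rho_x,\quad \sup_{\tau\ge0}|\tilde\epsilon(\tau)|\le\rho_\epsilon,\quad \limsup_{\tau\to\infty}|\tilde x(\tau)|\le\nu_x,\quad \limsup_{\tau\to\infty}|\tilde\epsilon(\tau)|\le\nu_\epsilon,$$ and $0<\epsilon(\tau)<\overline\epsilon$ for all $\tau\ge0$. -/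

import Mathlib

open Set Filter Topology MeasureTheory Matrix
open scoped ENNReal

/-- Class `K` comparison functions (only the values on `[0, ∞)` matter). -/
structure ClassK (α : ℝ → ℝ) : Prop where
  continuousOn : ContinuousOn α (Ici 0)
  strictMonoOn : StrictMonoOn α (Ici 0)
  map_zero : α 0 = 0

/-- Class `K∞` comparison functions. -/
structure ClassKInf (α : ℝ → ℝ) : Prop extends ClassK α where
  tendsto_atTop : Tendsto α atTop atTop

/-- Class `KL` comparison functions. -/
structure ClassKL (β : ℝ → ℝ → ℝ) : Prop where
  continuousOn : ContinuousOn (fun z : ℝ × ℝ => β z.1 z.2) (Ici 0 ×ˢ Ici 0)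
  classK : ∀ t, 0 ≤ t → ClassK (fun r => β r t)
  antitoneOn : ∀ r, 0 ≤ r → AntitoneOn (β r) (Ici 0)
  tendsto_zero : ∀ r, 0 ≤ r → Tendsto (β r) atTop (𝓝 0)

/-- `xbar` is a solution on the whole line of `dx/dτ = F τ x`, and it is uniformly globally
asymptotically stable. -/
def IsUGASSolution {X : Type*} [NormedAddCommGroup X] [NormedSpace ℝ X]
    (F : ℝ → X → X) (xbar : ℝ → X) : Prop :=
  (∀ τ, HasDerivAt xbar (F τ (xbar τ)) τ) ∧
  ∃ β, ClassKL β ∧ ∀ (τ₀ : ℝ) (x : ℝ → X),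
    (∀ τ ∈ Ici τ₀, HasDerivWithinAt x (F τ (x τ)) (Ici τ₀) τ) →
    ∀ τ ∈ Ici τ₀, ‖x τ - xbar τ‖ ≤ β ‖x τ₀ - xbar τ₀‖ (τ - τ₀)

/-- Data of an AFM (exosystem, XY and Z actuators and controllers, sample topography) together
with the data of the performance function. -/
structure AFM (nr no nc nzo nzc : ℕ) where
  /-- exosystem matrix, a function of `N` -/
  Ar : ℝ → Matrix (Fin nr) (Fin nr) ℝ
  Cr : Matrix (Fin 2) (Fin nr) ℝ
  /-- set of exosystem states -/
  Dr : Set (EuclideanSpace ℝ (Fin nr))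
  /-- XY actuator -/
  Ao : Matrix (Fin no) (Fin no) ℝ
  Bo : Matrix (Fin no) (Fin 2) ℝ
  Co : Matrix (Fin 2) (Fin no) ℝ
  /-- XY controller, functions of `ε` and `N` -/
  Ac : ℝ → ℝ → Matrix (Fin nc) (Fin nc) ℝ
  Bc : ℝ → ℝ → Matrix (Fin nc) (Fin 2) ℝ
  Cc : ℝ → ℝ → Matrix (Fin 2) (Fin nc) ℝ
  /-- Z actuator (single input, single output) -/
  Azo : Matrix (Fin nzo) (Fin nzo) ℝ
  Bzo : Fin nzo → ℝ
  Czo : Fin nzo → ℝ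
  /-- Z controller (single input, single output) -/
  Azc : Matrix (Fin nzc) (Fin nzc) ℝ
  Bzc : Fin nzc → ℝ
  Czc : Fin nzc → ℝ
  /-- sample topography -/
  fs : (Fin 2 → ℝ) → ℝ
  /-- nominal line period -/
  Tl : ℝ
  /-- exponent of the line error norm -/
  p : ℝ≥0∞
  /-- delay of the scan rate channel -/
  τφ : ℝ
  ge : ℝ → ℝ
  gs : ℝ → ℝ

namespace AFM

/-- The joint state `(ξ_o, ξ_c, ξ_zo, ξ_zc)` with the Euclidean norm. -/
abbrev State (no nc nzo nzc : ℕ) : Type :=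
  EuclideanSpace ℝ (Fin no ⊕ Fin nc ⊕ Fin nzo ⊕ Fin nzc)

variable {nr no nc nzo nzc : ℕ}

/-- The four blocks of a state. -/
def xo (x : State no nc nzo nzc) : Fin no → ℝ := fun i => x (Sum.inl i)

def xc (x : State no nc nzo nzc) : Fin nc → ℝ := fun i => x (Sum.inr (Sum.inl i))

def xzo (x : State no nc nzo nzc) : Fin nzo → ℝ := fun i => x (Sum.inr (Sum.inr (Sum.inl i)))

def xzc (x : State no nc nzo nzc) : Fin nzc → ℝ := fun i => x (Sum.inr (Sum.inr (Sum.inr i)))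

variable (S : AFM nr no nc nzo nzc)

/-- XY tracking error `e = p - r`. -/
def h (x : State no nc nzo nzc) (ξ : EuclideanSpace ℝ (Fin nr)) : Fin 2 → ℝ :=
  S.Co *ᵥ xo x - S.Cr *ᵥ (fun i => ξ i)

/-- Z regulation error `e_z = p_z + f_s(p)`. -/
def hz (x : State no nc nzo nzc) : ℝ :=
  S.Czo ⬝ᵥ xzo x + S.fs (S.Co *ᵥ xo x)

/-- Right-hand side of the AFM dynamics in the `τ`-timescale: since `dτ/dt = ε`, it is the
right-hand side in the time `t` divided by `ε`. -/
noncomputable def f (x : State no nc nzo nzc) (ξ : EuclideanSpace ℝ (Fin nr)) (ε N : ℝ) :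
    State no nc nzo nzc :=
  ε⁻¹ • WithLp.toLp 2
    (Sum.elim (S.Ao *ᵥ xo x + S.Bo *ᵥ (S.Cc ε N *ᵥ xc x))
      (Sum.elim (S.Ac ε N *ᵥ xc x + S.Bc ε N *ᵥ S.h x ξ)
        (Sum.elim (S.Azo *ᵥ xzo x + (S.Czc ⬝ᵥ xzc x) • S.Bzo)
          (S.Azc *ᵥ xzc x + S.hz x • S.Bzc))))

/-- The flow `exp (τ A_r(N))` of the exosystem in the `τ`-timescale. -/
noncomputable def exoFlow (N τ : ℝ) :
    EuclideanSpace ℝ (Fin nr) →L[ℝ] EuclideanSpace ℝ (Fin nr) :=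
  NormedSpace.exp (τ • Matrix.toEuclideanCLM (n := Fin nr) (𝕜 := ℝ) (S.Ar N))

/-- The solution `ξ_r` of `dξ_r/dτ = A_r(N) ξ_r` with `ξ_r(0) = ξ₀`. -/
noncomputable def exo (N : ℝ) (ξ₀ : EuclideanSpace ℝ (Fin nr)) (τ : ℝ) :
    EuclideanSpace ℝ (Fin nr) :=
  S.exoFlow N τ ξ₀

/-- `f̃(x̃, ξ, ε, N)`, the dynamics relative to the steady state `M`. -/
noncomputable def fTilde (M : EuclideanSpace ℝ (Fin nr) → ℝ → ℝ → State no nc nzo nzc)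
    (xt : State no nc nzo nzc) (ξ : EuclideanSpace ℝ (Fin nr)) (ε N : ℝ) :
    State no nc nzo nzc :=
  S.f (xt + M ξ ε N) ξ ε N - S.f (M ξ ε N) ξ ε N

open Classical in
/-- `L_e`: the normalised `L_p` norm of `e` over the line `[τ - T_l, τ]`. -/
noncomputable def lineError (e : ℝ → ℝ) (τ : ℝ) : ℝ :=
  if S.p = ∞ then sSup ((fun σ => |e σ|) '' Icc (τ - S.Tl) τ)
  else ((1 / S.Tl) * ∫ σ in (τ - S.Tl)..τ, |e σ| ^ S.p.toReal) ^ (1 / S.p.toReal)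

/-- The steady-state cost map `J̄(ε, N, τ)` along the exosystem solution from `ξ₀`. -/
noncomputable def costBar (M : EuclideanSpace ℝ (Fin nr) → ℝ → ℝ → State no nc nzo nzc)
    (ξ₀ : EuclideanSpace ℝ (Fin nr)) (ε N τ : ℝ) : ℝ :=
  S.ge (S.lineError (fun σ => S.hz (M (S.exo N ξ₀ σ) ε N)) τ) + S.gs ε

/-! ### Assumptions -/

/-- Constraints on the performance function, and regularity in `ε` of the XY controller. -/
structure Regular (εbar Nmin : ℝ) : Prop where
  Tl_pos : 0 < S.Tl
  one_le_p : 1 ≤ S.p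
  τφ_mem : S.τφ ∈ Icc 0 S.Tl
  ge_smooth : ContDiff ℝ 1 S.ge
  gs_smooth : ContDiff ℝ 1 S.gs
  Ac_smooth : ∀ N, Nmin ≤ N → ∀ i j, ContDiffOn ℝ 1 (fun ε => S.Ac ε N i j) (Ioc 0 εbar)
  Bc_smooth : ∀ N, Nmin ≤ N → ∀ i j, ContDiffOn ℝ 1 (fun ε => S.Bc ε N i j) (Ioc 0 εbar)
  Cc_smooth : ∀ N, Nmin ≤ N → ∀ i j, ContDiffOn ℝ 1 (fun ε => S.Cc ε N i j) (Ioc 0 εbar)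

/-- The exosystem is neutrally stable (its flow is bounded in forward and backward time), and
`D_r` is a set of states of it, that is, solutions that start in `D_r` remain in `D_r`. -/
structure ExosystemAssumption (Nmin : ℝ) : Prop where
  neutrally_stable : ∀ N, Nmin ≤ N → ∃ C, ∀ τ, ‖S.exoFlow N τ‖ ≤ C
  invariant : ∀ N, Nmin ≤ N → ∀ ξ₀ ∈ S.Dr, ∀ τ, S.exo N ξ₀ τ ∈ S.Dr

/-- The sample topography is a smooth static map. -/
def TopographyAssumption : Prop := ContDiff ℝ 1 S.fs

/-- The AFM has a UGAS steady state `M(ξ_r(τ), ε, N)`, smooth uniformly in `N`, with zero XY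
error and nearly periodic Z error, and there is a Lyapunov function, smooth uniformly in `N`. -/
structure SteadyStateAssumption (εbar Nmin : ℝ)
    (M : EuclideanSpace ℝ (Fin nr) → ℝ → ℝ → State no nc nzo nzc) : Prop where
  smooth : ∀ N, Nmin ≤ N → ContDiffOn ℝ 1
    (fun z : EuclideanSpace ℝ (Fin nr) × ℝ => M z.1 z.2 N) (S.Dr ×ˢ Ioc 0 εbar)
  bounded : ∃ B, ∀ N, Nmin ≤ N → ∀ ξ ∈ S.Dr, ∀ ε ∈ Ioc 0 εbar, ‖M ξ ε N‖ ≤ B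
  deriv_bounded : ∀ c, 0 < c → ∃ B, ∀ N, Nmin ≤ N → ∀ ξ ∈ S.Dr, ∀ ε ∈ Icc c εbar,
    ‖derivWithin (fun e => M ξ e N) (Ioc 0 εbar) ε‖ ≤ B
  ugas : ∀ N, Nmin ≤ N → ∀ ξ₀ ∈ S.Dr, ∀ ε ∈ Ioc 0 εbar,
    IsUGASSolution (fun τ x => S.f x (S.exo N ξ₀ τ) ε N) (fun τ => M (S.exo N ξ₀ τ) ε N)
  tracking : ∀ N, Nmin ≤ N → ∀ ξ₀ ∈ S.Dr, ∀ ε ∈ Ioc 0 εbar, ∀ τ,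
    S.h (M (S.exo N ξ₀ τ) ε N) (S.exo N ξ₀ τ) = 0
  regulation : ∃ ke, 0 < ke ∧ ∀ N, Nmin ≤ N → ∀ ξ₀ ∈ S.Dr, ∀ ε ∈ Ioc 0 εbar, ∀ τ,
    |S.hz (M (S.exo N ξ₀ (τ + S.Tl)) ε N) - S.hz (M (S.exo N ξ₀ τ) ε N)| ≤ ke / N
  lyapunov : ∃ (α₁ α₂ αf : ℝ → ℝ) (V : State no nc nzo nzc → ℝ → ℝ → ℝ),
    ClassKInf α₁ ∧ ClassKInf α₂ ∧ ClassK αf ∧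
    (∀ N, Nmin ≤ N → ContDiffOn ℝ 1
      (fun z : State no nc nzo nzc × ℝ => V z.1 z.2 N) (univ ×ˢ Ioc 0 εbar)) ∧
    (∀ R c, 0 < c → ∃ B, ∀ N, Nmin ≤ N → ∀ xt : State no nc nzo nzc, ‖xt‖ ≤ R →
      ∀ ε ∈ Icc c εbar, ‖fderiv ℝ (fun y => V y ε N) xt‖ ≤ B ∧
        |derivWithin (fun e => V xt e N) (Ioc 0 εbar) ε| ≤ B) ∧
    ∀ N, Nmin ≤ N → ∀ ε ∈ Ioc 0 εbar, ∀ xt : State no nc nzo nzc,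
      α₁ ‖xt‖ ≤ V xt ε N ∧ V xt ε N ≤ α₂ ‖xt‖ ∧
      ∀ ξ₀ ∈ S.Dr, ∀ τ, 0 ≤ τ →
        fderiv ℝ (fun y => V y ε N) xt (S.fTilde M xt (S.exo N ξ₀ τ) ε N) ≤ -αf ‖xt‖

/-- The steady-state cost map has a maximum at `ε*(N, τ)` (which, like the cost map, also depends
on the initial exosystem state). -/
structure CostAssumption (εbar Nmin : ℝ)
    (M : EuclideanSpace ℝ (Fin nr) → ℝ → ℝ → State no nc nzo nzc)
    (εstar : EuclideanSpace ℝ (Fin nr) → ℝ → ℝ → ℝ) : Prop where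
  differentiable : ∀ N, Nmin ≤ N → ∀ ξ₀ ∈ S.Dr, ∀ τ,
    DifferentiableOn ℝ (fun ε => S.costBar M ξ₀ ε N τ) (Ioc 0 εbar) ∧
    DifferentiableOn ℝ (derivWithin (fun ε => S.costBar M ξ₀ ε N τ) (Ioc 0 εbar)) (Ioc 0 εbar)
  bounded : ∃ B, ∀ N, Nmin ≤ N → ∀ ξ₀ ∈ S.Dr, ∀ ε ∈ Ioc 0 εbar, ∀ τ,
    |S.costBar M ξ₀ ε N τ| ≤ B ∧
    |derivWithin (fun ε => S.costBar M ξ₀ ε N τ) (Ioc 0 εbar) ε| ≤ B ∧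
    |derivWithin (derivWithin (fun ε => S.costBar M ξ₀ ε N τ) (Ioc 0 εbar)) (Ioc 0 εbar) ε| ≤ B
  isMax : ∀ N, Nmin ≤ N → ∀ ξ₀ ∈ S.Dr, ∀ τ, εstar ξ₀ N τ ∈ Ioc 0 εbar ∧
    IsMaxOn (fun ε => S.costBar M ξ₀ ε N τ) (Ioc 0 εbar) (εstar ξ₀ N τ)
  gradient : ∃ αJ, ClassK αJ ∧ ∀ N, Nmin ≤ N → ∀ ξ₀ ∈ S.Dr, ∀ ε ∈ Ioc 0 εbar, ∀ τ,
    derivWithin (fun ε => S.costBar M ξ₀ ε N τ) (Ioc 0 εbar) ε * (ε - εstar ξ₀ N τ)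
      ≤ -αJ |ε - εstar ξ₀ N τ|
  range : ∃ εlo ∈ Ioo 0 εbar, ∃ εhi ∈ Ioo 0 εbar, ∀ N, Nmin < N → ∀ ξ₀ ∈ S.Dr, ∀ τ,
    εlo ≤ εstar ξ₀ N τ ∧ εstar ξ₀ N τ ≤ εhi

/-- The steady-state cost map and its maximiser vary slowly in `τ`. -/
structure SlowVariationAssumption (εbar Nmin : ℝ)
    (M : EuclideanSpace ℝ (Fin nr) → ℝ → ℝ → State no nc nzo nzc)
    (εstar : EuclideanSpace ℝ (Fin nr) → ℝ → ℝ → ℝ) : Prop where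
  cost_smooth : ∀ N, Nmin ≤ N → ∀ ξ₀ ∈ S.Dr, ∀ ε ∈ Ioc 0 εbar,
    ContDiff ℝ 1 (fun τ => S.costBar M ξ₀ ε N τ)
  star_smooth : ∀ N, Nmin ≤ N → ∀ ξ₀ ∈ S.Dr, ContDiff ℝ 1 (fun τ => εstar ξ₀ N τ)
  cost_slow : ∃ kJ, 0 < kJ ∧ ∀ N, Nmin ≤ N → ∀ ξ₀ ∈ S.Dr, ∀ ε ∈ Ioc 0 εbar, ∀ τ,
    |deriv (fun τ => S.costBar M ξ₀ ε N τ) τ| ≤ kJ / N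
  star_slow : ∃ kε, 0 < kε ∧ ∀ N, Nmin ≤ N → ∀ ξ₀ ∈ S.Dr, ∀ τ,
    |deriv (fun τ => εstar ξ₀ N τ) τ| ≤ kε / N

/-! ### The extremum-seeking closed loop -/

/-- Length `τ_d` of the histories. -/
noncomputable def histLength (ω : ℝ) : ℝ := S.Tl + 2 * Real.pi / ω

/-- The estimate `ε̂ = ε̃ + ε*`. -/
def estimate (εstar : EuclideanSpace ℝ (Fin nr) → ℝ → ℝ → ℝ)
    (ξ₀ : EuclideanSpace ℝ (Fin nr)) (N : ℝ) (εt : ℝ → ℝ) (τ : ℝ) : ℝ :=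
  εt τ + εstar ξ₀ N τ

/-- The scan rate multiplier `ε = ε̂ + a sin(ωτ)`. -/
noncomputable def scanRate (εstar : EuclideanSpace ℝ (Fin nr) → ℝ → ℝ → ℝ)
    (ξ₀ : EuclideanSpace ℝ (Fin nr)) (a ω N : ℝ) (εt : ℝ → ℝ) (τ : ℝ) : ℝ :=
  estimate εstar ξ₀ N εt τ + a * Real.sin (ω * τ)

/-- The performance output `q = J(x̃[τ], ξ_r[τ], ε[τ], N)`. -/
noncomputable def performance
    (M : EuclideanSpace ℝ (Fin nr) → ℝ → ℝ → State no nc nzo nzc)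
    (ξ₀ : EuclideanSpace ℝ (Fin nr)) (N : ℝ) (xt : ℝ → State no nc nzo nzc) (ε : ℝ → ℝ)
    (τ : ℝ) : ℝ :=
  S.ge (S.lineError (fun σ => S.hz (xt σ + M (S.exo N ξ₀ σ) (ε σ) N)) τ) + S.gs (ε (τ - S.τφ))

/-- The adaptation law: `dε̂/dτ = a² ω δ η`, where `η` is the estimated gradient. -/
noncomputable def adaptation
    (M : EuclideanSpace ℝ (Fin nr) → ℝ → ℝ → State no nc nzo nzc)
    (ξ₀ : EuclideanSpace ℝ (Fin nr)) (a ω δ N : ℝ) (xt : ℝ → State no nc nzo nzc) (ε : ℝ → ℝ)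
    (τ : ℝ) : ℝ :=
  a * ω ^ 2 * δ / Real.pi * ∫ σ in (τ - 2 * Real.pi / ω)..τ,
    S.performance M ξ₀ N xt ε σ * Real.sin (ω * (σ - S.τφ))

/-- `(x̃, ε̃)`, with the initial histories `φx`, `φε` on `[-τ_d, 0]`, solves the closed loop for
`τ ≥ 0`, the exosystem state being `ξ_r(τ)` with `ξ_r(0) = ξ₀`. -/
structure IsClosedLoopSolution (εbar : ℝ)
    (M : EuclideanSpace ℝ (Fin nr) → ℝ → ℝ → State no nc nzo nzc)
    (εstar : EuclideanSpace ℝ (Fin nr) → ℝ → ℝ → ℝ)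
    (a ω δ N : ℝ) (ξ₀ : EuclideanSpace ℝ (Fin nr))
    (φx : ℝ → State no nc nzo nzc) (φε : ℝ → ℝ)
    (xt : ℝ → State no nc nzo nzc) (εt : ℝ → ℝ) : Prop where
  history_x : EqOn xt φx (Icc (-S.histLength ω) 0)
  history_ε : EqOn εt φε (Icc (-S.histLength ω) 0)
  deriv_x : ∀ τ ∈ Ici (0 : ℝ), HasDerivWithinAt xt
    (S.fTilde M (xt τ) (S.exo N ξ₀ τ) (scanRate εstar ξ₀ a ω N εt τ) N
      - (S.adaptation M ξ₀ a ω δ N xt (scanRate εstar ξ₀ a ω N εt) τ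
          + a * ω * Real.cos (ω * τ)) •
        derivWithin (fun e => M (S.exo N ξ₀ τ) e N) (Ioc 0 εbar)
          (scanRate εstar ξ₀ a ω N εt τ))
    (Ici 0) τ
  deriv_ε : ∀ τ ∈ Ici (0 : ℝ), HasDerivWithinAt εt
    (S.adaptation M ξ₀ a ω δ N xt (scanRate εstar ξ₀ a ω N εt) τ
      - deriv (fun s => εstar ξ₀ N s) τ)
    (Ici 0) τ

/-- Admissible initial condition: continuous histories on `[-τ_d, 0]` within the given radii, with
scan rates in the range `(0, ε̄]` where the steady state is defined, and `ε̂(0)` within the margin. -/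
structure IsAdmissibleHistory (εbar : ℝ)
    (εstar : EuclideanSpace ℝ (Fin nr) → ℝ → ℝ → ℝ)
    (a ω N : ℝ) (ξ₀ : EuclideanSpace ℝ (Fin nr)) (ρx0 ρε0 νεp : ℝ)
    (φx : ℝ → State no nc nzo nzc) (φε : ℝ → ℝ) : Prop where
  continuous_x : ContinuousOn φx (Icc (-S.histLength ω) 0)
  continuous_ε : ContinuousOn φε (Icc (-S.histLength ω) 0)
  bound_x : ∀ τ ∈ Icc (-S.histLength ω) 0, ‖φx τ‖ ≤ ρx0
  bound_ε : ∀ τ ∈ Icc (-S.histLength ω) 0, |φε τ| ≤ ρε0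
  range : ∀ τ ∈ Icc (-S.histLength ω) 0, scanRate εstar ξ₀ a ω N φε τ ∈ Ioc 0 εbar
  margin : estimate εstar ξ₀ N φε 0 ∈ Icc νεp (εbar - νεp)

end AFM

/-!
The proof is a singular-perturbation and averaging argument on three separated time scales.

*Plant.* The scan rate moves at speed `O(a ω)`, so the Lyapunov function of the frozen plant, which
depends on the scan rate as a parameter, still decreases outside a small ball
(`lyapunov_slow_parameter`): the state stays within a radius `R` that does not depend on the
gains, and after a transient it is within any prescribed `η`, provided `ω` is small.

*Averaging.* Once the plant is that close to its steady state, the performance output at time `σ` is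
close to the steady-state cost at the delayed scan rate `ε(σ - τ_φ)`. This uses that the line error
is `1`-Lipschitz for the sup norm (`AFM.abs_lineError_sub_le`) and that the scan rate hardly moves
over a line. The dither contained in `ε(σ - τ_φ)` has exactly the phase of the demodulating signal
`sin (ω (σ - τ_φ))`, so integration over a period returns the gradient of the cost, with an
error that is made small by the choice of `a` (second-order term of the cost), then `ω`, then `δ`,
then `N` (`AFM.TrappedRun.abs_adaptation_sub_gradient_le`).

*Gradient ascent.* Far from the maximiser the gradient dominates this error and the drift of the
maximiser, so the estimate moves towards the maximiser at a definite rate, and it cannot approach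
the ends of the range of scan rates (`AFM.TrappedRun.estimate_converges`). During the transient of
the plant the adaptation law is only known to be bounded; a small `δ` keeps the estimate near its
initial value for that time.

These estimates are stated for runs that satisfy the inequalities `‖x̃‖ ≤ R` and `c ≤ ε ≤ ε̄ - c`, and
they return the same inequalities strictly (`AFM.exists_gains`); by continuity the inequalities are
never violated (`AFM.forall_mem_region`). Existence of a solution uses the same principle: in the
variables plant state and estimate, and after cutting off both to compact sets, the closed loop is a
delay equation whose right-hand side is bounded and Lipschitz in the past of the solution, hence
globally solvable (`exists_solution_of_causal_lipschitz`), and the cutoffs are never active. In the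
original variable `x̃` the right-hand side contains `∂M/∂ε`, which is merely continuous, so a
Lipschitz argument needs this change of variables.
-/

/-! ### Continuation, comparison and delay equations -/

/-- A continuous constraint `g < 0` that holds at time `0`, and that holds strictly at `T` as soon
as it holds weakly on `[0, T]`, holds for all time. -/
theorem neg_of_forall_nonpos_imp_neg {g : ℝ → ℝ} (hg : ContinuousOn g (Ici 0)) (h0 : g 0 < 0)
    (h : ∀ T, 0 ≤ T → (∀ t ∈ Icc 0 T, g t ≤ 0) → g T < 0) : ∀ t, 0 ≤ t → g t < 0 := by
  intro t ht
  by_contra! hlt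
  have hgt : ContinuousOn g (Icc 0 t) := hg.mono Icc_subset_Ici_self
  -- `T` is the first time at which `g` vanishes
  have hcl : IsClosed (Icc 0 t ∩ g ⁻¹' Ici 0) := 
    hgt.preimage_isClosed_of_isClosed isClosed_Icc isClosed_Ici
  have hbd : BddBelow (Icc 0 t ∩ g ⁻¹' Ici 0) := ⟨0, fun x hx => hx.1.1⟩
  have hT := hcl.csInf_mem ⟨t, ⟨ht, le_rfl⟩, hlt⟩ hbd
  set T := sInf (Icc 0 t ∩ g ⁻¹' Ici 0) with hTdef
  have hbefore : ∀ s ∈ Ico 0 T, g s < 0 := by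
    intro s hs
    by_contra! hs'
    exact absurd (csInf_le hbd ⟨⟨hs.1, hs.2.le.trans hT.1.2⟩, hs'⟩) (not_le.2 hs.2)
  have hTpos : 0 < T := by
    rcases hT.1.1.eq_or_lt with h1 | h1
    · have := hT.2; rw [← h1] at this; exact absurd h0 (not_lt.2 this)
    · exact h1
  have hTle : g T ≤ 0 := by
    have hc : ContinuousWithinAt g (Ico 0 T) T :=
      (hgt T hT.1).mono fun s hs => ⟨hs.1, hs.2.le.trans hT.1.2⟩
    have hcl : T ∈ closure (Ico 0 T) := by
      rw [closure_Ico hTpos.ne]; exact ⟨hTpos.le, le_rfl⟩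
    have := hc.mem_closure hcl (t := Iic 0) fun s hs => (hbefore s hs).le
    simpa using this
  refine absurd (h T hTpos.le fun s hs => ?_) (not_lt.2 hT.2)
  rcases hs.2.eq_or_lt with h1 | h1
  · exact h1 ▸ hTle
  · exact (hbefore s ⟨hs.1, h1⟩).le

/-- Comparison lemma: a function that decreases at rate at least `m` wherever it is at least `b`
reaches the level `b` in finite time and stays below it afterwards. -/
theorem le_max_of_deriv_le_neg {v v' : ℝ → ℝ} {t₀ T b m : ℝ} (hm : 0 < m)
    (hc : ContinuousOn v (Icc t₀ T))
    (hd : ∀ t ∈ Ico t₀ T, HasDerivWithinAt v (v' t) (Ici t) t)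
    (h : ∀ t ∈ Ico t₀ T, b ≤ v t → v' t ≤ -m) :
    ∀ t ∈ Icc t₀ T, v t ≤ max (v t₀ - m * (t - t₀)) b := by
  intro t ht
  by_cases hex : ∃ s ∈ Icc t₀ t, v s ≤ b
  · obtain ⟨s, hs, hsb⟩ := hex
    refine le_max_of_le_right ?_
    refine image_le_of_deriv_right_lt_deriv_boundary (B := fun _ => b) (B' := fun _ => 0)
      (a := s) (b := T) (hc.mono (Icc_subset_Icc_left hs.1)) (f' := v')
      (fun x hx => hd x ⟨hs.1.trans hx.1, hx.2⟩) hsb (fun x => hasDerivAt_const x b) ?_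
      ⟨hs.2, ht.2⟩
    intro x hx hxb
    linarith [h x ⟨hs.1.trans hx.1, hx.2⟩ hxb.ge]
  · push Not at hex
    refine le_max_of_le_left ?_
    refine image_le_of_deriv_right_le_deriv_boundary (f := v) (f' := v') (a := t₀) (b := t)
      (B := fun s => v t₀ - m * (s - t₀)) (B' := fun _ => -m)
      (hc.mono (Icc_subset_Icc_right ht.2)) (fun x hx => hd x ⟨hx.1, hx.2.trans_le ht.2⟩)
      (by simp) (by fun_prop) (fun x _ => ?_) (fun x hx => ?_) ⟨ht.1, le_rfl⟩
    · have : HasDerivAt (fun s => v t₀ - m * (s - t₀)) (-(m * 1)) x :=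
        (((hasDerivAt_id x).sub_const t₀).const_mul m).const_sub (v t₀)
      simpa using this.hasDerivWithinAt
    · exact h x ⟨hx.1, hx.2.trans_le ht.2⟩ (hex x ⟨hx.1, hx.2.le⟩).le

/-- Partial derivative in the last variable of a function differentiable within `A ×ˢ I`. -/
theorem HasFDerivWithinAt.hasDerivWithinAt_snd {E F : Type*} [NormedAddCommGroup E]
    [NormedSpace ℝ E] [NormedAddCommGroup F] [NormedSpace ℝ F] {g : E → ℝ → F} {A : Set E}
    {I : Set ℝ} {D : E × ℝ →L[ℝ] F} {y : E} {e : ℝ} (hy : y ∈ A)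
    (hD : HasFDerivWithinAt (fun z : E × ℝ => g z.1 z.2) D (A ×ˢ I) (y, e)) :
    HasDerivWithinAt (g y) (D (0, 1)) I e := by
  have h1 : HasDerivWithinAt (fun s : ℝ => (y, s)) ((0 : E), (1 : ℝ)) I e :=
    (hasDerivWithinAt_const e I y).prodMk (hasDerivWithinAt_id e I)
  exact hD.comp_hasDerivWithinAt e h1 fun s hs => ⟨hy, hs⟩

/-- Chain rule along a path `(y, e)` in `A ×ˢ I`, where only within-set derivatives exist: the
total derivative splits into the part along `y` and the one-sided partial derivative in `e`. -/
theorem HasFDerivWithinAt.hasDerivWithinAt_prod_path {E F : Type*} [NormedAddCommGroup E]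
    [NormedSpace ℝ E] [NormedAddCommGroup F] [NormedSpace ℝ F] {g : E → ℝ → F} {A : Set E}
    {I : Set ℝ} {D : E × ℝ →L[ℝ] F} {y : ℝ → E} {e : ℝ → ℝ} {U : Set ℝ} {t : ℝ} {y' : E} {e' : ℝ}
    (hI : UniqueDiffOn ℝ I)
    (hU : ∀ s ∈ U, y s ∈ A ∧ e s ∈ I) (ht : t ∈ U)
    (hD : HasFDerivWithinAt (fun z : E × ℝ => g z.1 z.2) D (A ×ˢ I) (y t, e t))
    (hy : HasDerivWithinAt y y' U t) (he : HasDerivWithinAt e e' U t) :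
    HasDerivWithinAt (fun s => g (y s) (e s)) (D (y', 0) + e' • derivWithin (g (y t)) I (e t))
      U t := by
  have h1 : HasDerivWithinAt (fun s : ℝ => (y s, e s)) (y', e') U t := hy.prodMk he
  have h2 := hD.comp_hasDerivWithinAt t h1 fun s hs => hU s hs
  have h3 : derivWithin (g (y t)) I (e t) = D (0, 1) :=
    (hD.hasDerivWithinAt_snd (hU t ht).1).derivWithin (hI _ (hU t ht).2)
  have h4 : D (y', e') = D (y', 0) + e' • D (0, 1) := by
    rw [← map_smul, ← map_add]; simp
  rw [h3, ← h4]; exact h2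

/-- Existence for functional differential equations `y' = F t y` with initial history `ψ`, where
`F t y` is bounded, and depends only on the past of `y`, in a Lipschitz way for the sup norm.
The proof is a contraction in a weighted sup norm. -/
theorem exists_solution_of_causal_lipschitz {E : Type*} [NormedAddCommGroup E] [NormedSpace ℝ E]
    [CompleteSpace E] (F : ℝ → (ℝ → E) → E) (ψ : ℝ → E) (hψ : Continuous ψ) (K L : ℝ)
    (hcont : ∀ y, Continuous y → Continuous fun t => F t y)
    (hbound : ∀ t y, Continuous y → ‖F t y‖ ≤ K)
    (hL : 0 ≤ L)
    (hlip : ∀ t y z d, Continuous y → Continuous z → (∀ s ≤ t, ‖y s - z s‖ ≤ d) →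
      ‖F t y - F t z‖ ≤ L * d) :
    ∃ y : ℝ → E, Continuous y ∧ (∀ t ≤ 0, y t = ψ t) ∧
      ∀ t ∈ Ici (0 : ℝ), HasDerivWithinAt y (F t y) (Ici 0) t := by
  have hK : 0 ≤ K := (norm_nonneg _).trans (hbound 0 ψ hψ)
  set l : ℝ := 2 * L + 1 with hl
  have hlpos : 0 < l := by positivity
  -- the path attached to a weighted deviation `u`
  let Y : (BoundedContinuousFunction ℝ E) → ℝ → E := fun u t =>
    ψ (min t 0) + Real.exp (l * max t 0) • u (max t 0)
  have hY : ∀ u, Continuous (Y u) := fun u => by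
    have := u.continuous
    fun_prop
  have hint : ∀ u, Continuous fun t => ∫ s in (0 : ℝ)..t, F s (Y u) := fun u =>
    intervalIntegral.continuous_primitive
      (fun a b => (hcont _ (hY u)).intervalIntegrable a b) 0
  have hΦb : ∀ u t, ‖Real.exp (-(l * max t 0)) • ∫ s in (0 : ℝ)..(max t 0), F s (Y u)‖ ≤ K / l := by
    intro u t
    have h0 : 0 ≤ max t 0 := le_max_right _ _
    have h1 : ‖∫ s in (0 : ℝ)..(max t 0), F s (Y u)‖ ≤ K * |max t 0 - 0| :=
      intervalIntegral.norm_integral_le_of_norm_le_const fun s _ => hbound s _ (hY u)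
    rw [sub_zero, abs_of_nonneg h0] at h1
    rw [norm_smul, Real.norm_eq_abs, Real.abs_exp, Real.exp_neg, inv_mul_le_iff₀ (Real.exp_pos _)]
    have h2 : l * max t 0 ≤ Real.exp (l * max t 0) := by
      linarith [Real.add_one_le_exp (l * max t 0)]
    calc _ ≤ K * max t 0 := h1
      _ = l * max t 0 * (K / l) := by field_simp
      _ ≤ _ := by gcongr
  let Φ : (BoundedContinuousFunction ℝ E) → (BoundedContinuousFunction ℝ E) := fun u =>
    BoundedContinuousFunction.ofNormedAddCommGroup
      (fun t => Real.exp (-(l * max t 0)) • ∫ s in (0 : ℝ)..(max t 0), F s (Y u))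
      (by have := hint u; fun_prop) (K / l) (hΦb u)
  have hΦ : ∀ u t, Φ u t = Real.exp (-(l * max t 0)) • ∫ s in (0 : ℝ)..(max t 0), F s (Y u) :=
    fun u t => rfl
  have hcontr : ContractingWith (1 / 2) Φ := by
    refine ⟨by norm_num, LipschitzWith.of_dist_le_mul fun u w => ?_⟩
    rw [BoundedContinuousFunction.dist_le (by positivity)]
    intro t
    set τ := max t 0 with hτ
    have h0 : 0 ≤ τ := le_max_right _ _
    rw [dist_eq_norm, hΦ, hΦ, ← smul_sub, ← hτ,
      ← intervalIntegral.integral_sub ((hcont _ (hY u)).intervalIntegrable _ _)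
        ((hcont _ (hY w)).intervalIntegrable _ _)]
    have hb : ∀ s ∈ Ioc 0 τ, ‖F s (Y u) - F s (Y w)‖ ≤ L * (Real.exp (l * s) * dist u w) := by
      intro s hs
      refine hlip s _ _ _ (hY u) (hY w) fun r hr => ?_
      have : Y u r - Y w r = Real.exp (l * max r 0) • (u (max r 0) - w (max r 0)) := by
        simp only [Y, smul_sub]; abel
      rw [this, norm_smul, Real.norm_eq_abs, Real.abs_exp]
      have h3 : max r 0 ≤ s := max_le hr hs.1.le
      gcongr
      rw [← dist_eq_norm]; exact BoundedContinuousFunction.dist_coe_le_dist _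
    have hi : ∫ s in (0 : ℝ)..τ, L * (Real.exp (l * s) * dist u w)
        = L * (Real.exp (l * τ) - 1) / l * dist u w := by
      rw [intervalIntegral.integral_const_mul, intervalIntegral.integral_mul_const,
        intervalIntegral.integral_comp_mul_left (f := Real.exp) hlpos.ne', integral_exp]
      simp; field_simp
    have h4 : ‖∫ s in (0 : ℝ)..τ, (F s (Y u) - F s (Y w))‖
        ≤ L * (Real.exp (l * τ) - 1) / l * dist u w := by
      rw [← hi]
      exact intervalIntegral.norm_integral_le_of_norm_le h0 (Eventually.of_forall hb)
        (Continuous.intervalIntegrable (by fun_prop) _ _)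
    rw [norm_smul, Real.norm_eq_abs, Real.abs_exp, Real.exp_neg, inv_mul_le_iff₀ (Real.exp_pos _)]
    refine h4.trans ?_
    have h5 : L * (Real.exp (l * τ) - 1) / l ≤ Real.exp (l * τ) * (1 / 2) := by
      rw [div_le_iff₀ hlpos, hl]
      nlinarith [Real.exp_pos (l * τ)]
    calc _ ≤ Real.exp (l * τ) * (1 / 2) * dist u w := by gcongr
      _ = _ := by push_cast; ring
  obtain ⟨u, hu⟩ : ∃ u, Φ u = u := ⟨_, hcontr.fixedPoint_isFixedPt⟩
  have hut : ∀ t, u t = Real.exp (-(l * max t 0)) • ∫ s in (0 : ℝ)..(max t 0), F s (Y u) := by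
    intro t; rw [← hΦ, hu]
  refine ⟨Y u, hY u, fun t ht => ?_, fun t ht => ?_⟩
  · have : u 0 = 0 := by rw [hut]; simp
    simp [Y, min_eq_left ht, max_eq_right ht, this]
  · have h1 : ∀ s ∈ Ici (0 : ℝ), Y u s = ψ 0 + ∫ r in (0 : ℝ)..s, F r (Y u) := by
      intro s hs
      simp only [Y]
      rw [hut, max_eq_left (le_max_right s 0), max_eq_left (mem_Ici.1 hs),
        min_eq_right (mem_Ici.1 hs), smul_smul, ← Real.exp_add,
        add_neg_cancel, Real.exp_zero, one_smul]
    have h2 : HasDerivAt (fun s => ψ 0 + ∫ r in (0 : ℝ)..s, F r (Y u)) (F t (Y u)) t :=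
      (intervalIntegral.integral_hasDerivAt_right ((hcont _ (hY u)).intervalIntegrable _ _)
        (hcont _ (hY u)).aestronglyMeasurable.stronglyMeasurableAtFilter
        (hcont _ (hY u)).continuousAt).const_add (ψ 0)
    exact h2.hasDerivWithinAt.congr (fun s hs => h1 s hs) (h1 t ht)

theorem integral_sin_period {ω : ℝ} (hω : 0 < ω) (τ φ : ℝ) :
    ∫ σ in (τ - 2 * Real.pi / ω)..τ, Real.sin (ω * (σ - φ)) = 0 := by
  have h1 : ∀ σ, ω * (σ - φ) = ω * σ - ω * φ := fun σ => by ring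
  simp_rw [h1]
  rw [intervalIntegral.integral_comp_mul_sub (f := Real.sin) hω.ne', integral_sin]
  have : ω * (τ - 2 * Real.pi / ω) - ω * φ = ω * τ - ω * φ - 2 * Real.pi := by
    field_simp
    ring
  rw [this, Real.cos_sub_two_pi]; simp

theorem integral_sin_sq_period {ω : ℝ} (hω : 0 < ω) (τ φ : ℝ) :
    ∫ σ in (τ - 2 * Real.pi / ω)..τ, Real.sin (ω * (σ - φ)) ^ 2 = Real.pi / ω := by
  have h1 : ∀ σ, ω * (σ - φ) = ω * σ - ω * φ := fun σ => by ring
  simp_rw [h1]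
  rw [intervalIntegral.integral_comp_mul_sub (f := fun x => Real.sin x ^ 2) hω.ne', integral_sin_sq]
  have : ω * (τ - 2 * Real.pi / ω) - ω * φ = ω * τ - ω * φ - 2 * Real.pi := by
    field_simp
    ring
  rw [this, Real.cos_sub_two_pi, Real.sin_sub_two_pi]
  simp only [smul_eq_mul]
  field_simp
  ring

/-- Synchronous demodulation over a period: if `q` is an affine function of the dither up to an
error `E`, then its correlation with the dither gives the slope `D`. -/
theorem abs_integral_mul_sin_sub_le {q : ℝ → ℝ} {ω τ φ A a D E : ℝ} (hω : 0 < ω)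
    (hq : ContinuousOn q (Icc (τ - 2 * Real.pi / ω) τ))
    (hE : ∀ σ ∈ Icc (τ - 2 * Real.pi / ω) τ, |q σ - (A + a * Real.sin (ω * (σ - φ)) * D)| ≤ E) :
    |(∫ σ in (τ - 2 * Real.pi / ω)..τ, q σ * Real.sin (ω * (σ - φ))) - a * Real.pi / ω * D|
      ≤ 2 * Real.pi / ω * E := by
  have hle : τ - 2 * Real.pi / ω ≤ τ := by
    have : 0 < 2 * Real.pi / ω := by positivity
    linarith
  have hm : a * Real.pi / ω * D = ∫ σ in (τ - 2 * Real.pi / ω)..τ,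
      (A + a * Real.sin (ω * (σ - φ)) * D) * Real.sin (ω * (σ - φ)) := by
    have : ∀ σ, (A + a * Real.sin (ω * (σ - φ)) * D) * Real.sin (ω * (σ - φ))
        = A * Real.sin (ω * (σ - φ)) + (a * D) * Real.sin (ω * (σ - φ)) ^ 2 := fun σ => by ring
    simp_rw [this]
    rw [intervalIntegral.integral_add (Continuous.intervalIntegrable (by fun_prop) _ _)
      (Continuous.intervalIntegrable (by fun_prop) _ _), intervalIntegral.integral_const_mul,
      intervalIntegral.integral_const_mul, integral_sin_period hω, integral_sin_sq_period hω]
    ring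
  rw [hm, ← intervalIntegral.integral_sub]
  · have := intervalIntegral.norm_integral_le_of_norm_le_const (a := τ - 2 * Real.pi / ω) (b := τ)
      (C := E) (f := fun σ => q σ * Real.sin (ω * (σ - φ))
        - (A + a * Real.sin (ω * (σ - φ)) * D) * Real.sin (ω * (σ - φ))) (fun σ hσ => ?_)
    · rw [Real.norm_eq_abs] at this
      refine this.trans_eq ?_
      rw [sub_sub_cancel, abs_of_pos (by positivity)]; ring
    · rw [uIoc_of_le hle] at hσ
      rw [← sub_mul, Real.norm_eq_abs, abs_mul]
      have h1 := hE σ ⟨hσ.1.le, hσ.2⟩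
      have h2 := Real.abs_sin_le_one (ω * (σ - φ))
      calc _ ≤ E * 1 := mul_le_mul h1 h2 (abs_nonneg _) ((abs_nonneg _).trans h1)
        _ = E := mul_one E
  · refine ContinuousOn.intervalIntegrable ?_
    rw [uIcc_of_le hle]
    exact hq.mul (by fun_prop)
  · exact Continuous.intervalIntegrable (by fun_prop) _ _

/-! ### The line error and the smoothness of the plant -/

/-- A function that is `C¹` within a convex compact set is Lipschitz there. -/
theorem ContDiffOn.exists_lipschitz_of_convex_isCompact {E F : Type*} [NormedAddCommGroup E]
    [NormedSpace ℝ E] [NormedAddCommGroup F] [NormedSpace ℝ F] {f : E → F} {s : Set E}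
    (hf : ContDiffOn ℝ 1 f s) (hs : Convex ℝ s) (hc : IsCompact s) :
    ∃ K, 0 ≤ K ∧ ∀ x ∈ s, ∀ y ∈ s, ‖f x - f y‖ ≤ K * ‖x - y‖ := by
  have h : LocallyLipschitzOn s f := fun x hx => (hf x hx).exists_lipschitzOnWith hs
  obtain ⟨K, hK⟩ := h.exists_lipschitzOnWith_of_compact hc
  exact ⟨K, K.2, fun x hx y hy => by simpa [dist_eq_norm] using hK.dist_le_mul x hx y hy⟩

namespace AFM

variable {nr no nc nzo nzc : ℕ} (S : AFM nr no nc nzo nzc)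

theorem lineError_shift (e : ℝ → ℝ) (τ : ℝ) :
    S.lineError e τ = S.lineError (fun u => e (u + τ)) 0 := by
  unfold lineError
  split_ifs
  · congr 1
    have : Icc (τ - S.Tl) τ = (fun u => u + τ) '' Icc (0 - S.Tl) 0 := by
      rw [Set.image_add_const_Icc]; congr 1 <;> ring
    rw [this, Set.image_image]
  · rw [intervalIntegral.integral_comp_add_right (fun s => |e s| ^ S.p.toReal)]
    congr 3 <;> ring

/-- For finite `p`, the line error is the `L^p` norm for the uniform distribution on the line. -/
theorem lineError_eq_eLpNorm (hT : 0 < S.Tl) (hp : 1 ≤ S.p) (hp' : S.p ≠ ∞) {e : ℝ → ℝ} {τ : ℝ}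
    (he : ContinuousOn e (Icc (τ - S.Tl) τ)) :
    let μ := ENNReal.ofReal (1 / S.Tl) • volume.restrict (Ioc (τ - S.Tl) τ)
    MemLp e S.p μ ∧ S.lineError e τ = (eLpNorm e S.p μ).toReal := by
  intro μ
  have : IsFiniteMeasure (volume.restrict (Ioc (τ - S.Tl) τ)) := inferInstance
  have : IsFiniteMeasure μ :=
    ⟨by simp only [μ, Measure.smul_apply, smul_eq_mul]
        exact ENNReal.mul_lt_top ENNReal.ofReal_lt_top (measure_lt_top _ _)⟩
  obtain ⟨C, hC⟩ := isCompact_Icc.exists_bound_of_continuousOn he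
  have hm : MemLp e S.p μ := by
    refine MemLp.of_bound (C := C) ?_ ?_
    · exact ((he.mono Ioc_subset_Icc_self).aestronglyMeasurable measurableSet_Ioc).smul_measure _
    · refine Measure.ae_smul_measure ?_ _
      filter_upwards [ae_restrict_mem measurableSet_Ioc] with s hs
      exact hC s (Ioc_subset_Icc_self hs)
  refine ⟨hm, ?_⟩
  have hp0 : S.p ≠ 0 := (zero_lt_one.trans_le hp).ne'
  rw [hm.eLpNorm_eq_integral_rpow_norm hp0 hp', ENNReal.toReal_ofReal (by positivity),
    integral_smul_measure, ENNReal.toReal_ofReal (by positivity), lineError, if_neg hp',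
    intervalIntegral.integral_of_le (by linarith)]
  simp [one_div]

/-- The line error is `1`-Lipschitz for the sup norm over the line. -/
theorem abs_lineError_sub_le (hT : 0 < S.Tl) (hp : 1 ≤ S.p) {e₁ e₂ : ℝ → ℝ} {τ η : ℝ}
    (h₁ : ContinuousOn e₁ (Icc (τ - S.Tl) τ)) (h₂ : ContinuousOn e₂ (Icc (τ - S.Tl) τ))
    (h : ∀ s ∈ Icc (τ - S.Tl) τ, |e₁ s - e₂ s| ≤ η) :
    |S.lineError e₁ τ - S.lineError e₂ τ| ≤ η := by
  have key : ∀ {e₁ e₂ : ℝ → ℝ}, ContinuousOn e₁ (Icc (τ - S.Tl) τ) →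
      ContinuousOn e₂ (Icc (τ - S.Tl) τ) → (∀ s ∈ Icc (τ - S.Tl) τ, |e₁ s - e₂ s| ≤ η) →
      S.lineError e₁ τ ≤ S.lineError e₂ τ + η := by
    intro e₁ e₂ h₁ h₂ h
    have hne : (Icc (τ - S.Tl) τ).Nonempty := ⟨τ, by linarith, le_rfl⟩
    by_cases hp' : S.p = ∞
    · simp only [lineError, if_pos hp']
      refine csSup_le (hne.image _) ?_
      rintro _ ⟨s, hs, rfl⟩
      have hb : BddAbove ((fun σ => |e₂ σ|) '' Icc (τ - S.Tl) τ) :=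
        isCompact_Icc.bddAbove_image h₂.abs
      have h3 := le_csSup hb ⟨s, hs, rfl⟩
      have h4 := abs_sub_abs_le_abs_sub (e₁ s) (e₂ s)
      have h5 := h s hs
      simp only at h3 ⊢
      linarith
    · obtain ⟨m₁, E₁⟩ := S.lineError_eq_eLpNorm hT hp hp' h₁
      obtain ⟨m₂, E₂⟩ := S.lineError_eq_eLpNorm hT hp hp' h₂
      obtain ⟨m₃, E₃⟩ := S.lineError_eq_eLpNorm hT hp hp' (h₁.sub h₂)
      rw [E₁, E₂]
      set μ := ENNReal.ofReal (1 / S.Tl) • volume.restrict (Ioc (τ - S.Tl) τ) with hμ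
      have huniv : μ univ = 1 := by
        rw [hμ, Measure.smul_apply, Measure.restrict_apply_univ, Real.volume_Ioc, smul_eq_mul,
          ← ENNReal.ofReal_mul (by positivity)]
        rw [sub_sub_cancel, one_div, inv_mul_cancel₀ hT.ne', ENNReal.ofReal_one]
      have hη : 0 ≤ η := (abs_nonneg _).trans (h τ ⟨by linarith, le_rfl⟩)
      have h6 : eLpNorm (e₁ - e₂) S.p μ ≤ ENNReal.ofReal η := by
        refine (eLpNorm_le_of_ae_bound (C := η) ?_).trans ?_
        · refine Measure.ae_smul_measure ?_ _
          filter_upwards [ae_restrict_mem measurableSet_Ioc] with s hs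
          exact h s (Ioc_subset_Icc_self hs)
        · simp [huniv]
      have h7 : eLpNorm e₁ S.p μ ≤ eLpNorm e₂ S.p μ + ENNReal.ofReal η := by
        have h8 := eLpNorm_add_le m₂.1 (m₁.sub m₂).1 hp
        rw [add_sub_cancel] at h8
        exact h8.trans (add_le_add le_rfl h6)
      have h9 := ENNReal.toReal_mono
        (ENNReal.add_ne_top.2 ⟨m₂.eLpNorm_ne_top, ENNReal.ofReal_ne_top⟩) h7
      rwa [ENNReal.toReal_add m₂.eLpNorm_ne_top ENNReal.ofReal_ne_top,
        ENNReal.toReal_ofReal hη] at h9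
  rw [abs_le]
  constructor
  · linarith [key h₂ h₁ fun s hs => by rw [abs_sub_comm]; exact h s hs]
  · linarith [key h₁ h₂ h]

theorem lineError_zero (hT : 0 < S.Tl) (hp : 1 ≤ S.p) (τ : ℝ) :
    S.lineError (fun _ => 0) τ = 0 := by
  have hne : (Icc (τ - S.Tl) τ).Nonempty := ⟨τ, by linarith, le_rfl⟩
  unfold lineError
  split_ifs with hp'
  · simp [hne.image_const]
  · have : 0 < S.p.toReal := ENNReal.toReal_pos (zero_lt_one.trans_le hp).ne' hp'
    simp [Real.zero_rpow this.ne', Real.zero_rpow (inv_ne_zero this.ne')]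

theorem abs_lineError_le (hT : 0 < S.Tl) (hp : 1 ≤ S.p) {e : ℝ → ℝ} {τ H : ℝ}
    (he : ContinuousOn e (Icc (τ - S.Tl) τ)) (h : ∀ s ∈ Icc (τ - S.Tl) τ, |e s| ≤ H) :
    |S.lineError e τ| ≤ H := by
  simpa [S.lineError_zero hT hp] using
    S.abs_lineError_sub_le hT hp he (continuousOn_const (c := (0 : ℝ))) (by simpa using h)

theorem continuous_lineError (hT : 0 < S.Tl) (hp : 1 ≤ S.p) {e : ℝ → ℝ} (he : Continuous e) :
    Continuous (S.lineError e) := by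
  rw [Metric.continuous_iff]
  intro τ ε hε
  have huc := (isCompact_Icc (a := τ - S.Tl - 1) (b := τ + 1)).uniformContinuousOn_of_continuous
    he.continuousOn
  rw [Metric.uniformContinuousOn_iff] at huc
  obtain ⟨δ, hδ, hu⟩ := huc (ε / 2) (by positivity)
  refine ⟨min δ 1, by positivity, fun τ' hτ' => ?_⟩
  rw [S.lineError_shift e τ, S.lineError_shift e τ', Real.dist_eq]
  rw [Real.dist_eq, lt_min_iff, abs_lt] at hτ'
  refine lt_of_le_of_lt (S.abs_lineError_sub_le hT hp (η := ε / 2) (by fun_prop) (by fun_prop) ?_)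
    (by linarith)
  intro s hs
  have h1 := abs_lt.1 hτ'.2
  refine (hu (s + τ') ⟨by linarith [hs.1], by linarith [hs.2]⟩ (s + τ)
    ⟨by linarith [hs.1], by linarith [hs.2]⟩ ?_).le
  rw [Real.dist_eq, add_sub_add_left_eq_sub]
  exact abs_lt.2 hτ'.1

theorem continuousOn_lineError (hT : 0 < S.Tl) (hp : 1 ≤ S.p) {e : ℝ → ℝ} {t₀ t₁ : ℝ}
    (he : ContinuousOn e (Icc (t₀ - S.Tl) t₁)) : ContinuousOn (S.lineError e) (Icc t₀ t₁) := by
  rcases le_or_gt t₀ t₁ with h | h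
  · have hle : t₀ - S.Tl ≤ t₁ := by linarith
    -- extend `e` to a continuous function on the line
    have hext : Continuous (IccExtend hle ((Icc (t₀ - S.Tl) t₁).domRestrict e)) :=
      (continuousOn_iff_continuous_domRestrict.1 he).Icc_extend'
    refine (S.continuous_lineError hT hp hext).continuousOn.congr fun τ hτ => ?_
    have hsub : ∀ s ∈ Icc (τ - S.Tl) τ, s ∈ Icc (t₀ - S.Tl) t₁ := fun s hs =>
      ⟨by linarith [hs.1, hτ.1], hs.2.trans hτ.2⟩
    have := S.abs_lineError_sub_le hT hp (τ := τ) (η := 0) (he.mono hsub) hext.continuousOn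
      fun s hs => by simp [IccExtend_of_mem hle _ (hsub s hs)]
    exact sub_eq_zero.1 (abs_nonpos_iff.1 this)
  · simp [Icc_eq_empty (not_le.2 h)]

theorem contDiff_hz (htop : S.TopographyAssumption) :
    ContDiff ℝ 1 (S.hz : State no nc nzo nzc → ℝ) := by
  have hco : ∀ i, ContDiff ℝ 1 fun x : State no nc nzo nzc => x i := fun i =>
    (EuclideanSpace.proj (𝕜 := ℝ) i : State no nc nzo nzc →L[ℝ] ℝ).contDiff
  unfold hz
  refine ContDiff.add ?_ (ContDiff.comp (g := S.fs) htop ?_)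
  · simp only [dotProduct, xzo]
    exact ContDiff.sum fun i _ => contDiff_const.mul (hco _)
  · refine contDiff_pi.2 fun j => ?_
    simp only [Matrix.mulVec, dotProduct, xo]
    exact ContDiff.sum fun i _ => contDiff_const.mul (hco _)

/-- The plant is jointly smooth in state, exosystem state and scan rate. -/
theorem contDiffOn_f {εbar Nmin N : ℝ} (hreg : S.Regular εbar Nmin)
    (htop : S.TopographyAssumption) (hN : Nmin ≤ N) :
    ContDiffOn ℝ 1 (fun z : State no nc nzo nzc × EuclideanSpace ℝ (Fin nr) × ℝ =>
      S.f z.1 z.2.1 z.2.2 N) {z | z.2.2 ∈ Ioc 0 εbar} := by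
  set s : Set (State no nc nzo nzc × EuclideanSpace ℝ (Fin nr) × ℝ) := {z | z.2.2 ∈ Ioc 0 εbar}
  have hx : ∀ i, ContDiffOn ℝ 1 (fun z : State no nc nzo nzc × EuclideanSpace ℝ (Fin nr) × ℝ =>
      z.1 i) s := fun i =>
    ((EuclideanSpace.proj (𝕜 := ℝ) i : State no nc nzo nzc →L[ℝ] ℝ).contDiff.comp
      contDiff_fst).contDiffOn
  have hξ : ∀ i, ContDiffOn ℝ 1 (fun z : State no nc nzo nzc × EuclideanSpace ℝ (Fin nr) × ℝ =>
      z.2.1 i) s := fun i =>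
    ((EuclideanSpace.proj (𝕜 := ℝ) i : EuclideanSpace ℝ (Fin nr) →L[ℝ] ℝ).contDiff.comp
      (contDiff_fst.comp contDiff_snd)).contDiffOn
  have he : ContDiffOn ℝ 1 (fun z : State no nc nzo nzc × EuclideanSpace ℝ (Fin nr) × ℝ =>
      z.2.2) s := (contDiff_snd.comp contDiff_snd).contDiffOn
  have hpar : ∀ {g : ℝ → ℝ}, ContDiffOn ℝ 1 g (Ioc 0 εbar) → ContDiffOn ℝ 1
      (fun z : State no nc nzo nzc × EuclideanSpace ℝ (Fin nr) × ℝ => g z.2.2) s :=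
    fun hg => hg.comp he fun z hz => hz
  have hhz : ContDiffOn ℝ 1 (fun z : State no nc nzo nzc × EuclideanSpace ℝ (Fin nr) × ℝ =>
      S.hz z.1) s := ((S.contDiff_hz htop).comp contDiff_fst).contDiffOn
  unfold f
  refine ContDiffOn.smul (he.inv fun z hz => hz.1.ne') ?_
  rw [contDiffOn_euclidean]
  rintro (i | i | i | i) <;>
    simp only [Sum.elim_inl, Sum.elim_inr, Pi.add_apply, Pi.smul_apply, smul_eq_mul,
      Matrix.mulVec, dotProduct, xo, xc, xzo, xzc, h, Pi.sub_apply]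
  · refine (ContDiffOn.sum fun j _ => contDiffOn_const.mul (hx (Sum.inl j))).add
      (ContDiffOn.sum fun j _ => contDiffOn_const.mul (ContDiffOn.sum fun k _ =>
        (hpar (hreg.Cc_smooth N hN j k)).mul (hx (Sum.inr (Sum.inl k)))))
  · refine (ContDiffOn.sum fun j _ =>
      (hpar (hreg.Ac_smooth N hN i j)).mul (hx (Sum.inr (Sum.inl j)))).add
      (ContDiffOn.sum fun j _ => (hpar (hreg.Bc_smooth N hN i j)).mul
        ((ContDiffOn.sum fun k _ => contDiffOn_const.mul (hx (Sum.inl k))).sub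
          (ContDiffOn.sum fun k _ => contDiffOn_const.mul (hξ k))))
  · exact (ContDiffOn.sum fun j _ =>
      contDiffOn_const.mul (hx (Sum.inr (Sum.inr (Sum.inl j))))).add
      ((ContDiffOn.sum fun k _ =>
        contDiffOn_const.mul (hx (Sum.inr (Sum.inr (Sum.inr k))))).mul contDiffOn_const)
  · exact (ContDiffOn.sum fun j _ =>
      contDiffOn_const.mul (hx (Sum.inr (Sum.inr (Sum.inr j))))).add (hhz.mul contDiffOn_const)

end AFM

/-! ### The steady state, the performance output and the steady-state cost -/

/-- Second-order Taylor bound for derivatives within a convex set of reals. -/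
theorem abs_taylor_one_sub_le {J : ℝ → ℝ} {I : Set ℝ} {B x y : ℝ} (hI : Convex ℝ I)
    (h₁ : DifferentiableOn ℝ J I) (h₂ : DifferentiableOn ℝ (derivWithin J I) I)
    (hB : ∀ z ∈ I, |derivWithin (derivWithin J I) I z| ≤ B) (hx : x ∈ I) (hy : y ∈ I) :
    |J y - (J x + (y - x) * derivWithin J I x)| ≤ B * (y - x) ^ 2 := by
  have hsub : uIcc x y ⊆ I := by
    rw [← segment_eq_uIcc]; exact hI.segment_subset hx hy
  have hB0 : 0 ≤ B := (abs_nonneg _).trans (hB x hx)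
  have h := Convex.norm_image_sub_le_of_norm_hasDerivWithin_le (s := uIcc x y) (x := x) (y := y)
    (f := fun z => J z - (z - x) * derivWithin J I x)
    (f' := fun z => derivWithin J I z - 1 * derivWithin J I x) (C := B * |y - x|)
    (fun z hz => (((h₁ z (hsub hz)).hasDerivWithinAt).mono hsub).sub
      (((hasDerivWithinAt_id z _).sub_const x).mul_const _))
    (fun z hz => ?_) (convex_uIcc x y) left_mem_uIcc right_mem_uIcc
  · simp only [sub_self, zero_mul, sub_zero, Real.norm_eq_abs] at h
    calc _ = |J y - (y - x) * derivWithin J I x - J x| := by congr 1; ring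
      _ ≤ _ := h
      _ = B * |y - x| ^ 2 := by ring
      _ = _ := by rw [sq_abs]
  · rw [one_mul]
    refine (Convex.norm_image_sub_le_of_norm_derivWithin_le h₂ hB hI hx (hsub hz)).trans ?_
    gcongr
    exact abs_sub_left_of_mem_uIcc hz

namespace AFM

variable {nr no nc nzo nzc : ℕ} (S : AFM nr no nc nzo nzc)

theorem hasDerivAt_exo (N : ℝ) (ξ₀ : EuclideanSpace ℝ (Fin nr)) (τ : ℝ) :
    ∃ ξ', HasDerivAt (S.exo N ξ₀) ξ' τ :=
  ⟨_, (hasDerivAt_exp_smul_const (𝕂 := ℝ)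
    (Matrix.toEuclideanCLM (n := Fin nr) (𝕜 := ℝ) (S.Ar N)) τ).clm_apply
      (hasDerivAt_const τ ξ₀)⟩

theorem continuous_exo (N : ℝ) (ξ₀ : EuclideanSpace ℝ (Fin nr)) : Continuous (S.exo N ξ₀) :=
  continuous_iff_continuousAt.2 fun τ => (S.hasDerivAt_exo N ξ₀ τ).choose_spec.continuousAt

variable {S} {εbar Nmin : ℝ} {M : EuclideanSpace ℝ (Fin nr) → ℝ → ℝ → State no nc nzo nzc}
  {εstar : EuclideanSpace ℝ (Fin nr) → ℝ → ℝ → ℝ}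

namespace SteadyStateAssumption

theorem continuousOn_path (hss : S.SteadyStateAssumption εbar Nmin M)
    (hexo : S.ExosystemAssumption Nmin) {N : ℝ} (hN : Nmin ≤ N)
    {ξ₀ : EuclideanSpace ℝ (Fin nr)} (hξ : ξ₀ ∈ S.Dr) {ε : ℝ → ℝ} {U : Set ℝ}
    (hε : ContinuousOn ε U) (hr : ∀ s ∈ U, ε s ∈ Ioc 0 εbar) :
    ContinuousOn (fun s => M (S.exo N ξ₀ s) (ε s) N) U :=
  ((hss.smooth N hN).continuousOn).comp
    ((S.continuous_exo N ξ₀).continuousOn.prodMk hε)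
    fun s hs => ⟨hexo.invariant N hN ξ₀ hξ s, hr s hs⟩

theorem differentiableOn_snd (hss : S.SteadyStateAssumption εbar Nmin M) {N : ℝ} (hN : Nmin ≤ N)
    {ξ : EuclideanSpace ℝ (Fin nr)} (hξ : ξ ∈ S.Dr) :
    DifferentiableOn ℝ (fun e => M ξ e N) (Ioc 0 εbar) := fun e he =>
  ((((hss.smooth N hN).differentiableOn (by norm_num)) (ξ, e)
    ⟨hξ, he⟩).hasFDerivWithinAt.hasDerivWithinAt_snd
      (g := fun ξ e => M ξ e N) hξ).differentiableWithinAt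

/-- Away from `ε = 0` the steady state is Lipschitz in the scan rate. -/
theorem exists_lipschitz (hss : S.SteadyStateAssumption εbar Nmin M) {c : ℝ} (hc : 0 < c) :
    ∃ B, 0 ≤ B ∧ ∀ N, Nmin ≤ N → ∀ ξ ∈ S.Dr,
      (∀ e ∈ Icc c εbar, ‖derivWithin (fun e => M ξ e N) (Ioc 0 εbar) e‖ ≤ B) ∧
      ∀ e₁ ∈ Icc c εbar, ∀ e₂ ∈ Icc c εbar, ‖M ξ e₁ N - M ξ e₂ N‖ ≤ B * |e₁ - e₂| := by
  obtain ⟨B, hB⟩ := hss.deriv_bounded c hc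
  have hsub : Icc c εbar ⊆ Ioc 0 εbar := fun e he => ⟨hc.trans_le he.1, he.2⟩
  have hB' : ∀ N, Nmin ≤ N → ∀ ξ ∈ S.Dr, ∀ e ∈ Icc c εbar,
      ‖derivWithin (fun e => M ξ e N) (Ioc 0 εbar) e‖ ≤ |B| := fun N hN ξ hξ e he =>
    (hB N hN ξ hξ e he).trans (le_abs_self B)
  refine ⟨|B|, abs_nonneg _, fun N hN ξ hξ => ⟨hB' N hN ξ hξ, fun e₁ h₁ e₂ h₂ => ?_⟩⟩
  exact Convex.norm_image_sub_le_of_norm_hasDerivWithin_le (s := Icc c εbar)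
    (f := fun e => M ξ e N)
    (fun e he => ((hss.differentiableOn_snd hN hξ) e (hsub he)).hasDerivWithinAt.mono hsub)
    (hB' N hN ξ hξ) (convex_Icc _ _) h₂ h₁

/-- Along a varying scan rate the steady state moves with the plant vector field, plus the
contribution of the scan rate. -/
theorem hasDerivWithinAt_path (hss : S.SteadyStateAssumption εbar Nmin M)
    (hexo : S.ExosystemAssumption Nmin) {N : ℝ} (hN : Nmin ≤ N)
    {ξ₀ : EuclideanSpace ℝ (Fin nr)} (hξ : ξ₀ ∈ S.Dr) {ε : ℝ → ℝ} {U : Set ℝ} {t e' : ℝ}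
    (hr : ∀ s ∈ U, ε s ∈ Ioc 0 εbar) (ht : t ∈ U) (hε : HasDerivWithinAt ε e' U t) :
    HasDerivWithinAt (fun s => M (S.exo N ξ₀ s) (ε s) N)
      (S.f (M (S.exo N ξ₀ t) (ε t) N) (S.exo N ξ₀ t) (ε t) N
        + e' • derivWithin (fun e => M (S.exo N ξ₀ t) e N) (Ioc 0 εbar) (ε t)) U t := by
  obtain ⟨ξ', hξ'⟩ := S.hasDerivAt_exo N ξ₀ t
  have hD := (((hss.smooth N hN).differentiableOn (by norm_num)) (S.exo N ξ₀ t, ε t)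
    ⟨hexo.invariant N hN ξ₀ hξ t, hr t ht⟩).hasFDerivWithinAt
  have hI : UniqueDiffOn ℝ (Ioc (0 : ℝ) εbar) := uniqueDiffOn_Ioc _ _
  have h1 := hD.hasDerivWithinAt_prod_path (g := fun ξ e => M ξ e N) (y := S.exo N ξ₀)
    (e := fun _ => ε t) (U := univ) hI
    (fun s _ => ⟨hexo.invariant N hN ξ₀ hξ s, hr t ht⟩) (mem_univ t)
    hξ'.hasDerivWithinAt (hasDerivWithinAt_const t _ (ε t))
  have h2 := (hss.ugas N hN ξ₀ hξ (ε t) (hr t ht)).1 t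
  rw [zero_smul, add_zero, hasDerivWithinAt_univ] at h1
  beta_reduce at h2
  rw [← h1.unique h2]
  exact hD.hasDerivWithinAt_prod_path (g := fun ξ e => M ξ e N) (y := S.exo N ξ₀)
    (e := ε) hI (fun s hs => ⟨hexo.invariant N hN ξ₀ hξ s, hr s hs⟩) ht
    hξ'.hasDerivWithinAt hε

end SteadyStateAssumption

theorem exists_hz_lipschitz (htop : S.TopographyAssumption) (R : ℝ) :
    ∃ L, 0 ≤ L ∧ ∀ x, ‖x‖ ≤ R → ∀ y, ‖y‖ ≤ R → |S.hz x - S.hz y| ≤ L * ‖x - y‖ := by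
  obtain ⟨K, hK, h⟩ := (S.contDiff_hz htop).contDiffOn.exists_lipschitz_of_convex_isCompact
    (convex_closedBall (0 : State no nc nzo nzc) R) (isCompact_closedBall 0 R)
  exact ⟨K, hK, fun x hx y hy => h x (by simpa using hx) y (by simpa using hy)⟩

theorem exists_hz_bound (htop : S.TopographyAssumption) (R : ℝ) :
    ∃ H, 0 ≤ H ∧ ∀ x : State no nc nzo nzc, ‖x‖ ≤ R → |S.hz x| ≤ H := by
  obtain ⟨C, hC⟩ := (isCompact_closedBall (0 : State no nc nzo nzc) R).exists_bound_of_continuousOn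
    (S.contDiff_hz htop).continuous.continuousOn
  exact ⟨|C|, abs_nonneg _, fun x hx =>
    (hC x (by simpa using hx)).trans (le_abs_self C)⟩

theorem continuousOn_error (htop : S.TopographyAssumption)
    (hss : S.SteadyStateAssumption εbar Nmin M)
    (hexo : S.ExosystemAssumption Nmin) {N : ℝ} (hN : Nmin ≤ N)
    {ξ₀ : EuclideanSpace ℝ (Fin nr)} (hξ : ξ₀ ∈ S.Dr) {xt : ℝ → State no nc nzo nzc} {ε : ℝ → ℝ}
    {U : Set ℝ} (hx : ContinuousOn xt U) (hε : ContinuousOn ε U)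
    (hr : ∀ s ∈ U, ε s ∈ Ioc 0 εbar) :
    ContinuousOn (fun s => S.hz (xt s + M (S.exo N ξ₀ s) (ε s) N)) U :=
  (S.contDiff_hz htop).continuous.comp_continuousOn
    (hx.add (hss.continuousOn_path hexo hN hξ hε hr))

theorem delayed_mem (hreg : S.Regular εbar Nmin) (σ : ℝ) : σ - S.τφ ∈ Icc (σ - S.Tl) σ :=
  ⟨by linarith [hreg.τφ_mem.2], by linarith [hreg.τφ_mem.1]⟩

theorem continuousOn_performance (hreg : S.Regular εbar Nmin) (htop : S.TopographyAssumption)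
    (hss : S.SteadyStateAssumption εbar Nmin M)
    (hexo : S.ExosystemAssumption Nmin) {N : ℝ} (hN : Nmin ≤ N)
    {ξ₀ : EuclideanSpace ℝ (Fin nr)} (hξ : ξ₀ ∈ S.Dr) {xt : ℝ → State no nc nzo nzc} {ε : ℝ → ℝ}
    {t₀ t₁ : ℝ} (hx : ContinuousOn xt (Icc (t₀ - S.Tl) t₁))
    (hε : ContinuousOn ε (Icc (t₀ - S.Tl) t₁)) (hr : ∀ s ∈ Icc (t₀ - S.Tl) t₁, ε s ∈ Ioc 0 εbar) :
    ContinuousOn (S.performance M ξ₀ N xt ε) (Icc t₀ t₁) := by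
  refine (hreg.ge_smooth.continuous.comp_continuousOn
    (S.continuousOn_lineError hreg.Tl_pos hreg.one_le_p
      (continuousOn_error htop hss hexo hN hξ hx hε hr))).add
    (hreg.gs_smooth.continuous.comp_continuousOn (hε.comp (by fun_prop) fun σ hσ => ?_))
  have := delayed_mem hreg σ
  exact ⟨by linarith [this.1, hσ.1], this.2.trans hσ.2⟩

theorem exists_performance_bound (hreg : S.Regular εbar Nmin) (htop : S.TopographyAssumption)
    (hss : S.SteadyStateAssumption εbar Nmin M) (hexo : S.ExosystemAssumption Nmin) (R : ℝ) :
    ∃ Q, 0 < Q ∧ ∀ N, Nmin ≤ N → ∀ ξ₀ ∈ S.Dr, ∀ (xt : ℝ → State no nc nzo nzc) (ε : ℝ → ℝ) (σ : ℝ),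
      ContinuousOn xt (Icc (σ - S.Tl) σ) → ContinuousOn ε (Icc (σ - S.Tl) σ) →
      (∀ s ∈ Icc (σ - S.Tl) σ, ‖xt s‖ ≤ R ∧ ε s ∈ Ioc 0 εbar) →
      |S.performance M ξ₀ N xt ε σ| ≤ Q := by
  obtain ⟨B, hB⟩ := hss.bounded
  obtain ⟨H, hH0, hH⟩ := exists_hz_bound htop (R + B)
  obtain ⟨G, hG⟩ := (isCompact_Icc (a := -H) (b := H)).exists_bound_of_continuousOn
    hreg.ge_smooth.continuous.continuousOn
  obtain ⟨G', hG'⟩ := (isCompact_Icc (a := 0) (b := εbar)).exists_bound_of_continuousOn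
    hreg.gs_smooth.continuous.continuousOn
  refine ⟨|G| + |G'| + 1, by positivity, fun N hN ξ₀ hξ xt ε σ hx hε h => ?_⟩
  have h1 := S.abs_lineError_le hreg.Tl_pos hreg.one_le_p
    (continuousOn_error htop hss hexo hN hξ hx hε fun s hs => (h s hs).2) (H := H) fun s hs =>
      hH _ ((norm_add_le _ _).trans (add_le_add (h s hs).1
        (hB N hN _ (hexo.invariant N hN ξ₀ hξ s) _ (h s hs).2)))
  have h2 := hG _ (abs_le.1 h1)
  have h3 := hG' _ (Ioc_subset_Icc_self (h _ (delayed_mem hreg σ)).2)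
  rw [Real.norm_eq_abs] at h2 h3
  unfold performance
  refine (abs_add_le _ _).trans ?_
  linarith [le_abs_self G, le_abs_self G']

/-- When the plant is near its steady state and the scan rate nearly constant over a line, the
performance output is close to the steady-state cost at the delayed scan rate. -/
theorem exists_performance_sub_costBar_le (hreg : S.Regular εbar Nmin)
    (htop : S.TopographyAssumption) (hss : S.SteadyStateAssumption εbar Nmin M)
    (hexo : S.ExosystemAssumption Nmin) (R : ℝ) {c : ℝ} (hc : 0 < c) :
    ∃ L, 0 < L ∧ ∀ N, Nmin ≤ N → ∀ ξ₀ ∈ S.Dr, ∀ (xt : ℝ → State no nc nzo nzc) (ε : ℝ → ℝ)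
      (σ η d : ℝ), η ≤ R →
      ContinuousOn xt (Icc (σ - S.Tl) σ) → ContinuousOn ε (Icc (σ - S.Tl) σ) →
      (∀ s ∈ Icc (σ - S.Tl) σ, ‖xt s‖ ≤ η ∧ ε s ∈ Icc c εbar ∧ |ε s - ε (σ - S.τφ)| ≤ d) →
      |S.performance M ξ₀ N xt ε σ - S.costBar M ξ₀ (ε (σ - S.τφ)) N σ| ≤ L * (η + d) := by
  obtain ⟨B, hB⟩ := hss.bounded
  obtain ⟨H, hH0, hH⟩ := exists_hz_bound htop (R + B)
  obtain ⟨Lh, hLh0, hLh⟩ := exists_hz_lipschitz htop (R + B)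
  obtain ⟨LM, hLM0, hLM⟩ := hss.exists_lipschitz hc
  obtain ⟨G, hG0, hG⟩ := hreg.ge_smooth.contDiffOn.exists_lipschitz_of_convex_isCompact
    (convex_Icc (-H) H) isCompact_Icc
  refine ⟨G * (Lh * (1 + LM)) + 1, by positivity, fun N hN ξ₀ hξ xt ε σ η d hηR hx hε h => ?_⟩
  have hd0 := delayed_mem hreg σ
  have hη : 0 ≤ η := (norm_nonneg _).trans (h _ hd0).1
  have hd : 0 ≤ d := (abs_nonneg _).trans (h _ hd0).2.2
  have hIoc : ∀ s ∈ Icc (σ - S.Tl) σ, ε s ∈ Ioc 0 εbar := fun s hs =>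
    ⟨hc.trans_le (h s hs).2.1.1, (h s hs).2.1.2⟩
  have hDr := hexo.invariant N hN ξ₀ hξ
  have c1 := continuousOn_error htop hss hexo hN hξ hx hε hIoc
  have c2 : ContinuousOn (fun s => S.hz (M (S.exo N ξ₀ s) (ε (σ - S.τφ)) N))
      (Icc (σ - S.Tl) σ) := by
    simpa using continuousOn_error htop hss hexo hN hξ (xt := fun _ => 0)
      (ε := fun _ => ε (σ - S.τφ)) (U := Icc (σ - S.Tl) σ) continuousOn_const continuousOn_const
      fun _ _ => hIoc _ hd0
  have b1 : ∀ s ∈ Icc (σ - S.Tl) σ, ‖xt s + M (S.exo N ξ₀ s) (ε s) N‖ ≤ R + B := fun s hs =>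
    (norm_add_le _ _).trans (add_le_add ((h s hs).1.trans hηR) (hB N hN _ (hDr s) _ (hIoc s hs)))
  have b2 : ∀ s ∈ Icc (σ - S.Tl) σ, ‖M (S.exo N ξ₀ s) (ε (σ - S.τφ)) N‖ ≤ R + B := fun s hs =>
    (hB N hN _ (hDr s) _ (hIoc _ hd0)).trans (by linarith)
  have h1 := S.abs_lineError_le hreg.Tl_pos hreg.one_le_p c1 fun s hs => hH _ (b1 s hs)
  have h2 := S.abs_lineError_le hreg.Tl_pos hreg.one_le_p c2 fun s hs => hH _ (b2 s hs)
  have h3 := S.abs_lineError_sub_le hreg.Tl_pos hreg.one_le_p c1 c2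
    (η := Lh * (1 + LM) * (η + d)) fun s hs => by
      refine (hLh _ (b1 s hs) _ (b2 s hs)).trans ?_
      rw [mul_assoc]
      gcongr
      rw [add_sub_assoc]
      have h4 := (hLM N hN _ (hDr s)).2 _ (h s hs).2.1 _ (h _ hd0).2.1
      have h5 : LM * |ε s - ε (σ - S.τφ)| ≤ LM * d := by gcongr; exact (h s hs).2.2
      nlinarith [norm_add_le (xt s) (M (S.exo N ξ₀ s) (ε s) N
        - M (S.exo N ξ₀ s) (ε (σ - S.τφ)) N), (h s hs).1, mul_nonneg hLM0 hη]
  unfold performance costBar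
  rw [add_sub_add_right_eq_sub]
  refine (hG _ (abs_le.1 h1) _ (abs_le.1 h2)).trans ?_
  rw [Real.norm_eq_abs]
  calc _ ≤ G * (Lh * (1 + LM) * (η + d)) := by gcongr
    _ ≤ _ := by nlinarith

/-- The steady-state cost near `(e, τ)`: affine in the scan rate up to second order, Lipschitz in
the scan rate and slowly varying in time. -/
theorem exists_costBar_expansion (hcost : S.CostAssumption εbar Nmin M εstar)
    (hslow : S.SlowVariationAssumption εbar Nmin M εstar) :
    ∃ B, 0 < B ∧ ∃ kJ, 0 < kJ ∧ ∀ N, Nmin ≤ N → ∀ ξ₀ ∈ S.Dr, ∀ e ∈ Ioc 0 εbar,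
      ∀ e₁ ∈ Ioc 0 εbar, ∀ e₂ ∈ Ioc 0 εbar, ∀ σ τ,
      |S.costBar M ξ₀ e₂ N σ - (S.costBar M ξ₀ e N τ
        + (e₁ - e) * derivWithin (fun ε => S.costBar M ξ₀ ε N τ) (Ioc 0 εbar) e)|
        ≤ kJ / N * |σ - τ| + B * |e₂ - e₁| + B * (e₁ - e) ^ 2 := by
  obtain ⟨B, hB⟩ := hcost.bounded
  obtain ⟨kJ, hkJ, hk⟩ := hslow.cost_slow
  refine ⟨|B| + 1, by positivity, kJ, hkJ, fun N hN ξ₀ hξ e he e₁ he₁ e₂ he₂ σ τ => ?_⟩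
  have hBB : B ≤ |B| + 1 := by linarith [le_abs_self B]
  have hd := hcost.differentiable N hN ξ₀ hξ τ
  have h1 := abs_taylor_one_sub_le (convex_Ioc 0 εbar) hd.1 hd.2
    (fun z hz => ((hB N hN ξ₀ hξ z hz τ).2.2).trans hBB) he he₁
  have h2 := Convex.norm_image_sub_le_of_norm_derivWithin_le hd.1
    (fun z hz => ((hB N hN ξ₀ hξ z hz τ).2.1).trans hBB) (convex_Ioc 0 εbar) he₁ he₂
  have h3 := Convex.norm_image_sub_le_of_norm_deriv_le (x := τ) (y := σ) (s := univ)
    (fun t _ => ((hslow.cost_smooth N hN ξ₀ hξ e₂ he₂).differentiable (by norm_num)) t)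
    (fun t _ => hk N hN ξ₀ hξ e₂ he₂ t) convex_univ (mem_univ _) (mem_univ _)
  simp only [Real.norm_eq_abs] at h2 h3
  have h4 := abs_add_le (S.costBar M ξ₀ e₂ N σ - S.costBar M ξ₀ e₂ N τ)
    (S.costBar M ξ₀ e₂ N τ - S.costBar M ξ₀ e₁ N τ)
  have h5 := abs_add_le (S.costBar M ξ₀ e₂ N σ - S.costBar M ξ₀ e₂ N τ
    + (S.costBar M ξ₀ e₂ N τ - S.costBar M ξ₀ e₁ N τ)) (S.costBar M ξ₀ e₁ N τ
      - (S.costBar M ξ₀ e N τ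
        + (e₁ - e) * derivWithin (fun ε => S.costBar M ξ₀ ε N τ) (Ioc 0 εbar) e))
  refine le_trans (le_of_eq ?_) (h5.trans (add_le_add (h4.trans (add_le_add h3 h2)) h1))
  congr 1; ring

end AFM

/-! ### Trapped runs -/

/-- Lyapunov estimate under slow parameter variation. If `V` decreases at rate `αf` along `g` for
frozen parameter, the parameter moves at speed at most `μ` and disturbs the state by `e' • d`, and
`μ` is small relative to `αf r`, then `x` never leaves the ball of radius `R`, and it is within `η`
after an explicit time. -/
theorem lyapunov_slow_parameter {X : Type*} [NormedAddCommGroup X] [NormedSpace ℝ X]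
    {V : X → ℝ → ℝ} {I : Set ℝ} {α₁ α₂ αf : ℝ → ℝ} {x g d : ℝ → X} {e e' : ℝ → ℝ}
    {T ρ r η R B D μ : ℝ}
    (h₁ : ClassK α₁) (h₂ : ClassK α₂) (hf : ClassK αf)
    (hV : DifferentiableOn ℝ (fun z : X × ℝ => V z.1 z.2) (univ ×ˢ I)) (hI : UniqueDiffOn ℝ I)
    (hlow : ∀ y, ∀ p ∈ I, α₁ ‖y‖ ≤ V y p) (hup : ∀ y, ∀ p ∈ I, V y p ≤ α₂ ‖y‖)
    (hr : 0 < r) (hη : 0 < η) (hηR : η ≤ R)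
    (hρ : ‖x 0‖ ≤ ρ) (hρR : α₂ ρ < α₁ R) (hrη : α₂ r < α₁ η)
    (hx : ∀ t ∈ Icc 0 T, HasDerivWithinAt x (g t - e' t • d t) (Icc 0 T) t)
    (he : ∀ t ∈ Icc 0 T, HasDerivWithinAt e (e' t) (Icc 0 T) t)
    (heI : ∀ t ∈ Icc 0 T, e t ∈ I)
    (hdec : ∀ t ∈ Icc 0 T, fderiv ℝ (fun y => V y (e t)) (x t) (g t) ≤ -αf ‖x t‖)
    (hB0 : 0 ≤ B)
    (hB : ∀ t ∈ Icc 0 T, ‖fderiv ℝ (fun y => V y (e t)) (x t)‖ ≤ B ∧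
      |derivWithin (V (x t)) I (e t)| ≤ B)
    (hd : ∀ t ∈ Icc 0 T, ‖d t‖ ≤ D) (he' : ∀ t ∈ Icc 0 T, |e' t| ≤ μ)
    (hμ : B * (1 + D) * μ ≤ αf r / 2) :
    ∀ t ∈ Icc 0 T, ‖x t‖ < R ∧ (2 * α₂ ρ / αf r ≤ t → ‖x t‖ < η) := by
  intro t ht
  have hT : 0 ≤ T := ht.1.trans ht.2
  have h0 : (0 : ℝ) ∈ Icc 0 T := ⟨le_rfl, hT⟩
  have hm : 0 < αf r / 2 := by
    have := hf.strictMonoOn (mem_Ici.2 le_rfl) (mem_Ici.2 hr.le) hr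
    rw [hf.map_zero] at this; linarith
  have hder : ∀ s ∈ Icc 0 T, ∃ v', HasDerivWithinAt (fun s => V (x s) (e s)) v' (Icc 0 T) s ∧
      v' ≤ -αf ‖x s‖ + B * (1 + D) * μ := by
    intro s hs
    have hD := (hV (x s, e s) ⟨mem_univ _, heI s hs⟩).hasFDerivWithinAt
    set A := fderivWithin ℝ (fun z : X × ℝ => V z.1 z.2) (univ ×ˢ I) (x s, e s)
    have hA : HasFDerivAt (fun y => V y (e s)) (A.comp (ContinuousLinearMap.inl ℝ X ℝ)) (x s) := by
      have h := HasFDerivWithinAt.comp (f := fun y => (y, e s)) (s := univ) (x s) hD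
        (hasFDerivAt_prodMk_left (x s) (e s)).hasFDerivWithinAt
        fun y _ => ⟨mem_univ _, heI s hs⟩
      exact hasFDerivWithinAt_univ.1 h
    have hAe : ∀ w, A (w, 0) = fderiv ℝ (fun y => V y (e s)) (x s) w := fun w => by
      rw [hA.fderiv]; simp
    refine ⟨_, hD.hasDerivWithinAt_prod_path hI (fun u hu => ⟨mem_univ _, heI u hu⟩) hs
      (hx s hs) (he s hs), ?_⟩
    rw [hAe, map_sub, map_smul, smul_eq_mul, smul_eq_mul]
    have hDs := hd s hs
    have hb1 := (fderiv ℝ (fun y => V y (e s)) (x s)).le_of_opNorm_le (hB s hs).1 (d s)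
    have hb2 : |e' s * fderiv ℝ (fun y => V y (e s)) (x s) (d s)| ≤ μ * (B * D) := by
      rw [abs_mul]
      refine mul_le_mul (he' s hs) (hb1.trans (by gcongr)) (abs_nonneg _)
        ((abs_nonneg _).trans (he' s hs))
    have hb3 : |e' s * derivWithin (V (x s)) I (e s)| ≤ μ * B := by
      rw [abs_mul]
      exact mul_le_mul (he' s hs) (hB s hs).2 (abs_nonneg _) ((abs_nonneg _).trans (he' s hs))
    have := (abs_le.1 hb2).1
    have := (abs_le.1 hb3).2
    linarith [hdec s hs]
  choose! v' hv' hv'le using hder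
  have hcmp := le_max_of_deriv_le_neg (v := fun s => V (x s) (e s)) (v' := v') (t₀ := 0) (T := T)
    (b := α₂ r) hm (fun s hs => (hv' s hs).continuousWithinAt)
    (fun s hs => (hv' s (Ico_subset_Icc_self hs)).mono_of_mem_nhdsWithin
      (mem_of_superset (Icc_mem_nhdsGE hs.2) (Icc_subset_Icc_left hs.1)))
    (fun s hs hb => ?_) t ht
  · have hV0 : V (x 0) (e 0) ≤ α₂ ρ := (hup _ _ (heI 0 h0)).trans
      (h₂.strictMonoOn.monotoneOn (norm_nonneg _) ((norm_nonneg _).trans hρ) hρ)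
    have hα : α₁ η ≤ α₁ R := h₁.strictMonoOn.monotoneOn hη.le (hη.le.trans hηR) hηR
    have hback : ∀ {y : X} {s : ℝ}, 0 ≤ s → α₁ ‖y‖ < α₁ s → ‖y‖ < s := fun hs h =>
      (h₁.strictMonoOn.lt_iff_lt (norm_nonneg _) hs).1 h
    have hl := hlow (x t) (e t) (heI t ht)
    simp only [sub_zero] at hcmp
    refine ⟨hback (hη.le.trans hηR) (hl.trans_lt (hcmp.trans_lt (max_lt ?_ (hrη.trans_le hα)))),
      fun hle => hback hη.le (hl.trans_lt (hcmp.trans_lt (max_lt ?_ hrη)))⟩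
    · nlinarith [mul_nonneg hm.le ht.1]
    · rw [div_le_iff₀ (by linarith)] at hle
      have hα2 : α₂ 0 ≤ α₂ r := h₂.strictMonoOn.monotoneOn (mem_Ici.2 le_rfl) (mem_Ici.2 hr.le) hr.le
      rw [h₂.map_zero] at hα2
      linarith
  · have hs' := Ico_subset_Icc_self hs
    have hrx : r ≤ ‖x s‖ := (h₂.strictMonoOn.le_iff_le hr.le (norm_nonneg _)).1
      (hb.trans (hup _ _ (heI s hs')))
    have : αf r ≤ αf ‖x s‖ := hf.strictMonoOn.monotoneOn (mem_Ici.2 hr.le) (norm_nonneg _) hrx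
    linarith [hv'le s hs']

namespace AFM

variable {nr no nc nzo nzc : ℕ}

/-- A run of the closed loop on `[0, T]`, with its history on `[-τ_d, 0]`, during which the plant
stays within `R` of the steady state and the scan rate keeps a margin `c` from the ends of
`(0, ε̄)`. -/
structure TrappedRun (S : AFM nr no nc nzo nzc) (εbar Nmin : ℝ)
    (M : EuclideanSpace ℝ (Fin nr) → ℝ → ℝ → State no nc nzo nzc)
    (εstar : EuclideanSpace ℝ (Fin nr) → ℝ → ℝ → ℝ) (a ω δ N : ℝ) (ξ₀ : EuclideanSpace ℝ (Fin nr))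
    (R c T : ℝ) (xt : ℝ → State no nc nzo nzc) (εt : ℝ → ℝ) : Prop where
  le_N : Nmin < N
  mem_Dr : ξ₀ ∈ S.Dr
  a_pos : 0 < a
  ω_pos : 0 < ω
  δ_pos : 0 < δ
  continuousOn_x : ContinuousOn xt (Icc (-S.histLength ω) T)
  continuousOn_ε : ContinuousOn (scanRate εstar ξ₀ a ω N εt) (Icc (-S.histLength ω) T)
  bound_x : ∀ τ ∈ Icc (-S.histLength ω) T, ‖xt τ‖ ≤ R
  range : ∀ τ ∈ Icc (-S.histLength ω) T, scanRate εstar ξ₀ a ω N εt τ ∈ Ioc 0 εbar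
  margin : ∀ τ ∈ Icc 0 T, scanRate εstar ξ₀ a ω N εt τ ∈ Icc c (εbar - c)
  deriv_x : ∀ τ ∈ Icc 0 T, HasDerivWithinAt xt
    (S.fTilde M (xt τ) (S.exo N ξ₀ τ) (scanRate εstar ξ₀ a ω N εt τ) N
      - (S.adaptation M ξ₀ a ω δ N xt (scanRate εstar ξ₀ a ω N εt) τ
          + a * ω * Real.cos (ω * τ)) •
        derivWithin (fun e => M (S.exo N ξ₀ τ) e N) (Ioc 0 εbar)
          (scanRate εstar ξ₀ a ω N εt τ))
    (Icc 0 T) τ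
  deriv_ε : ∀ τ ∈ Icc 0 T, HasDerivWithinAt (estimate εstar ξ₀ N εt)
    (S.adaptation M ξ₀ a ω δ N xt (scanRate εstar ξ₀ a ω N εt) τ) (Icc 0 T) τ

namespace TrappedRun

variable {S : AFM nr no nc nzo nzc} {εbar Nmin : ℝ}
  {M : EuclideanSpace ℝ (Fin nr) → ℝ → ℝ → State no nc nzo nzc}
  {εstar : EuclideanSpace ℝ (Fin nr) → ℝ → ℝ → ℝ} {a ω δ N : ℝ} {ξ₀ : EuclideanSpace ℝ (Fin nr)}
  {R c T : ℝ} {xt : ℝ → State no nc nzo nzc} {εt : ℝ → ℝ}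

theorem abs_adaptation_le (h : TrappedRun S εbar Nmin M εstar a ω δ N ξ₀ R c T xt εt) {Q : ℝ}
    (hQ : ∀ σ ∈ Icc (-(2 * Real.pi / ω)) T,
      |S.performance M ξ₀ N xt (scanRate εstar ξ₀ a ω N εt) σ| ≤ Q) :
    ∀ τ ∈ Icc 0 T, |S.adaptation M ξ₀ a ω δ N xt (scanRate εstar ξ₀ a ω N εt) τ|
      ≤ 2 * a * ω * δ * Q := by
  intro τ hτ
  have ha := h.a_pos
  have hω := h.ω_pos
  have hδ := h.δ_pos
  have hp : 0 < 2 * Real.pi / ω := by positivity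
  have h1 := intervalIntegral.norm_integral_le_of_norm_le_const (a := τ - 2 * Real.pi / ω) (b := τ)
    (C := Q) (f := fun σ => S.performance M ξ₀ N xt (scanRate εstar ξ₀ a ω N εt) σ
      * Real.sin (ω * (σ - S.τφ))) (fun σ hσ => by
        rw [uIoc_of_le (by linarith)] at hσ
        have hq := hQ σ ⟨by linarith [hσ.1, hτ.1], hσ.2.trans hτ.2⟩
        rw [Real.norm_eq_abs, abs_mul]
        calc _ ≤ Q * 1 := mul_le_mul hq (Real.abs_sin_le_one _) (abs_nonneg _)
              ((abs_nonneg _).trans hq)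
          _ = Q := mul_one Q)
  rw [sub_sub_cancel, abs_of_pos hp, Real.norm_eq_abs] at h1
  rw [adaptation, abs_mul, abs_of_pos (by positivity)]
  calc _ ≤ a * ω ^ 2 * δ / Real.pi * (Q * (2 * Real.pi / ω)) := by gcongr
    _ = _ := by field_simp

theorem hasDerivWithinAt_scanRate (h : TrappedRun S εbar Nmin M εstar a ω δ N ξ₀ R c T xt εt) :
    ∀ τ ∈ Icc 0 T, HasDerivWithinAt (scanRate εstar ξ₀ a ω N εt)
      (S.adaptation M ξ₀ a ω δ N xt (scanRate εstar ξ₀ a ω N εt) τ + a * ω * Real.cos (ω * τ))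
      (Icc 0 T) τ := by
  intro τ hτ
  have h1 : HasDerivAt (fun τ => a * Real.sin (ω * τ)) (a * ω * Real.cos (ω * τ)) τ :=
    (((hasDerivAt_id' τ).const_mul ω).sin.const_mul a).congr_deriv (by ring)
  exact (h.deriv_ε τ hτ).add h1.hasDerivWithinAt

theorem abs_deriv_scanRate_le (h : TrappedRun S εbar Nmin M εstar a ω δ N ξ₀ R c T xt εt) {Q : ℝ}
    (hQ : ∀ σ ∈ Icc (-(2 * Real.pi / ω)) T,
      |S.performance M ξ₀ N xt (scanRate εstar ξ₀ a ω N εt) σ| ≤ Q) :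
    ∀ τ ∈ Icc 0 T, |S.adaptation M ξ₀ a ω δ N xt (scanRate εstar ξ₀ a ω N εt) τ
      + a * ω * Real.cos (ω * τ)| ≤ a * ω * (1 + 2 * δ * Q) := by
  intro τ hτ
  have ha := h.a_pos
  have hω := h.ω_pos
  have h1 := h.abs_adaptation_le hQ τ hτ
  have h2 : |a * ω * Real.cos (ω * τ)| ≤ a * ω * 1 := by
    rw [abs_mul, abs_of_pos (mul_pos ha hω)]
    gcongr
    exact Real.abs_cos_le_one _
  refine (abs_add_le _ _).trans ((add_le_add h1 h2).trans_eq (by ring))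

theorem abs_scanRate_sub_le (h : TrappedRun S εbar Nmin M εstar a ω δ N ξ₀ R c T xt εt) {Q : ℝ}
    (hQ : ∀ σ ∈ Icc (-(2 * Real.pi / ω)) T,
      |S.performance M ξ₀ N xt (scanRate εstar ξ₀ a ω N εt) σ| ≤ Q) {s t : ℝ}
    (hs : s ∈ Icc 0 T) (ht : t ∈ Icc 0 T) :
    |scanRate εstar ξ₀ a ω N εt s - scanRate εstar ξ₀ a ω N εt t|
      ≤ a * ω * (1 + 2 * δ * Q) * |s - t| :=
  Convex.norm_image_sub_le_of_norm_hasDerivWithin_le h.hasDerivWithinAt_scanRate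
    (h.abs_deriv_scanRate_le hQ) (convex_Icc 0 T) ht hs

theorem abs_estimate_sub_le (h : TrappedRun S εbar Nmin M εstar a ω δ N ξ₀ R c T xt εt) {Q : ℝ}
    (hQ : ∀ σ ∈ Icc (-(2 * Real.pi / ω)) T,
      |S.performance M ξ₀ N xt (scanRate εstar ξ₀ a ω N εt) σ| ≤ Q) {s t : ℝ}
    (hs : s ∈ Icc 0 T) (ht : t ∈ Icc 0 T) :
    |estimate εstar ξ₀ N εt s - estimate εstar ξ₀ N εt t| ≤ 2 * a * ω * δ * Q * |s - t| :=
  Convex.norm_image_sub_le_of_norm_hasDerivWithin_le h.deriv_ε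
    (h.abs_adaptation_le hQ) (convex_Icc 0 T) ht hs

theorem estimate_mem (h : TrappedRun S εbar Nmin M εstar a ω δ N ξ₀ R c T xt εt)
    (hac : 2 * a < c) : ∀ τ ∈ Icc 0 T, estimate εstar ξ₀ N εt τ ∈ Ioo a (εbar - a) := by
  intro τ hτ
  have h1 := h.margin τ hτ
  have h2 : |a * Real.sin (ω * τ)| ≤ a := by
    rw [abs_mul, abs_of_pos h.a_pos]
    exact mul_le_of_le_one_right h.a_pos.le (Real.abs_sin_le_one _)
  have h3 := abs_le.1 h2
  unfold scanRate at h1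
  constructor <;> linarith [h1.1, h1.2, h3.1, h3.2]

/-- Averaging: once the plant has been within `η` of its steady state for a whole history, the
adaptation law follows the gradient of the steady-state cost, up to an error `κ` in the gradient. -/
theorem abs_adaptation_sub_gradient_le
    (h : TrappedRun S εbar Nmin M εstar a ω δ N ξ₀ R c T xt εt)
    (hreg : S.Regular εbar Nmin) (htop : S.TopographyAssumption)
    (hss : S.SteadyStateAssumption εbar Nmin M) (hexo : S.ExosystemAssumption Nmin)
    (hNmin : 0 < Nmin) (hac : 2 * a < c)
    {Q Lq B kJ η κ t₀ : ℝ} (ht₀ : 0 ≤ t₀) (hη : η ≤ R) (hB : 0 < B) (hkJ : 0 < kJ)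
    (hQ0 : 0 < Q)
    (hQ : ∀ σ ∈ Icc (-(2 * Real.pi / ω)) T,
      |S.performance M ξ₀ N xt (scanRate εstar ξ₀ a ω N εt) σ| ≤ Q)
    (hperf : ∀ (xt : ℝ → State no nc nzo nzc) (ε : ℝ → ℝ) (σ η d : ℝ), η ≤ R →
      ContinuousOn xt (Icc (σ - S.Tl) σ) → ContinuousOn ε (Icc (σ - S.Tl) σ) →
      (∀ s ∈ Icc (σ - S.Tl) σ, ‖xt s‖ ≤ η ∧ ε s ∈ Icc c εbar ∧ |ε s - ε (σ - S.τφ)| ≤ d) →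
      |S.performance M ξ₀ N xt ε σ - S.costBar M ξ₀ (ε (σ - S.τφ)) N σ| ≤ Lq * (η + d))
    (hexp : ∀ e ∈ Ioc 0 εbar, ∀ e₁ ∈ Ioc 0 εbar, ∀ e₂ ∈ Ioc 0 εbar, ∀ σ τ,
      |S.costBar M ξ₀ e₂ N σ - (S.costBar M ξ₀ e N τ
        + (e₁ - e) * derivWithin (fun ε => S.costBar M ξ₀ ε N τ) (Ioc 0 εbar) e)|
        ≤ kJ / N * |σ - τ| + B * |e₂ - e₁| + B * (e₁ - e) ^ 2)
    (hx : ∀ s ∈ Icc t₀ T, ‖xt s‖ ≤ η)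
    (hE : Lq * (η + a * ω * (1 + 2 * δ * Q) * S.Tl) + kJ / N * (2 * Real.pi / ω)
      + B * (2 * a * ω * δ * Q * (2 * Real.pi / ω + S.Tl)) + B * a ^ 2 ≤ a * κ / 2) :
    ∀ τ ∈ Icc (t₀ + S.histLength ω) T,
      |S.adaptation M ξ₀ a ω δ N xt (scanRate εstar ξ₀ a ω N εt) τ
        - a ^ 2 * ω * δ * derivWithin (fun ε => S.costBar M ξ₀ ε N τ) (Ioc 0 εbar)
          (estimate εstar ξ₀ N εt τ)| ≤ a ^ 2 * ω * δ * κ := by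
  intro τ hτ
  have ha := h.a_pos
  have hω := h.ω_pos
  have hδ := h.δ_pos
  have hT := hreg.Tl_pos
  have hNpos : 0 < N := hNmin.trans h.le_N
  have hp : 0 < 2 * Real.pi / ω := by positivity
  have hhl : S.histLength ω = S.Tl + 2 * Real.pi / ω := rfl
  rw [hhl] at hτ
  have hτ0 : τ ∈ Icc 0 T := ⟨by linarith [hτ.1], hτ.2⟩
  set ε := scanRate εstar ξ₀ a ω N εt with hε
  set D := derivWithin (fun ε => S.costBar M ξ₀ ε N τ) (Ioc 0 εbar) (estimate εstar ξ₀ N εt τ)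
  have hcontx : ContinuousOn xt (Icc (τ - 2 * Real.pi / ω - S.Tl) τ) :=
    h.continuousOn_x.mono (Icc_subset_Icc (by rw [hhl]; linarith [hτ.1]) hτ.2)
  have hconte : ContinuousOn ε (Icc (τ - 2 * Real.pi / ω - S.Tl) τ) :=
    h.continuousOn_ε.mono (Icc_subset_Icc (by rw [hhl]; linarith [hτ.1]) hτ.2)
  have hq := continuousOn_performance hreg htop hss hexo h.le_N.le h.mem_Dr
    (t₀ := τ - 2 * Real.pi / ω) (t₁ := τ) hcontx hconte
    (fun s hs => h.range s ⟨by rw [hhl]; linarith [hτ.1, hs.1], hs.2.trans hτ.2⟩)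
  have hdem := abs_integral_mul_sin_sub_le (φ := S.τφ)
    (A := S.costBar M ξ₀ (estimate εstar ξ₀ N εt τ) N τ) (a := a) (D := D) (E := a * κ / 2) hω hq
    (fun σ hσ => ?_)
  · have : S.adaptation M ξ₀ a ω δ N xt ε τ - a ^ 2 * ω * δ * D = a * ω ^ 2 * δ / Real.pi *
        ((∫ σ in (τ - 2 * Real.pi / ω)..τ, S.performance M ξ₀ N xt ε σ
          * Real.sin (ω * (σ - S.τφ))) - a * Real.pi / ω * D) := by
      rw [adaptation]; field_simp
    rw [this, abs_mul, abs_of_pos (by positivity)]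
    calc _ ≤ a * ω ^ 2 * δ / Real.pi * (2 * Real.pi / ω * (a * κ / 2)) := by gcongr
      _ = _ := by field_simp
  · have hdel := delayed_mem hreg σ
    have hin : ∀ s ∈ Icc (σ - S.Tl) σ, s ∈ Icc t₀ T := fun s hs =>
      ⟨by linarith [hτ.1, hσ.1, hs.1], hs.2.trans (hσ.2.trans hτ.2)⟩
    have hin0 : ∀ s ∈ Icc (σ - S.Tl) σ, s ∈ Icc 0 T := fun s hs =>
      ⟨ht₀.trans (hin s hs).1, (hin s hs).2⟩
    have hσsub : Icc (σ - S.Tl) σ ⊆ Icc (τ - 2 * Real.pi / ω - S.Tl) τ :=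
      Icc_subset_Icc (by linarith [hσ.1]) hσ.2
    have h1 := hperf xt ε σ η (a * ω * (1 + 2 * δ * Q) * S.Tl) hη (hcontx.mono hσsub)
      (hconte.mono hσsub) fun s hs => ⟨hx s (hin s hs),
        ⟨(h.margin s (hin0 s hs)).1, by linarith [(h.margin s (hin0 s hs)).2]⟩, by
          refine (h.abs_scanRate_sub_le hQ (hin0 s hs) (hin0 _ hdel)).trans ?_
          gcongr
          exact abs_le.2 ⟨by linarith [hs.1, hdel.2], by linarith [hs.2, hdel.1]⟩⟩
    have hsin : |a * Real.sin (ω * (σ - S.τφ))| ≤ a := by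
      rw [abs_mul, abs_of_pos ha]
      exact mul_le_of_le_one_right ha.le (Real.abs_sin_le_one _)
    have hest := h.estimate_mem hac τ hτ0
    -- the estimate keeps a distance `a` from the ends of the range, so the probed points lie in it
    have hsin' := abs_le.1 hsin
    have hεσ := h.range (σ - S.τφ) ⟨by rw [hhl]; linarith [(hin0 _ hdel).1], (hin0 _ hdel).2⟩
    have h2 := hexp (estimate εstar ξ₀ N εt τ) ⟨by linarith [hest.1], by linarith [hest.2]⟩
      (estimate εstar ξ₀ N εt τ + a * Real.sin (ω * (σ - S.τφ)))
      ⟨by linarith [hest.1], by linarith [hest.2]⟩ _ hεσ σ τ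
    rw [add_sub_cancel_left] at h2
    have h3 : |ε (σ - S.τφ) - (estimate εstar ξ₀ N εt τ + a * Real.sin (ω * (σ - S.τφ)))|
        ≤ 2 * a * ω * δ * Q * (2 * Real.pi / ω + S.Tl) := by
      rw [hε, scanRate, add_sub_add_right_eq_sub]
      refine (h.abs_estimate_sub_le hQ (hin0 _ hdel) hτ0).trans ?_
      gcongr
      exact abs_le.2 ⟨by linarith [hσ.1, hdel.1], by linarith [hσ.2, hdel.2]⟩
    have h4 : kJ / N * |σ - τ| ≤ kJ / N * (2 * Real.pi / ω) := by
      gcongr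
      exact abs_le.2 ⟨by linarith [hσ.1], by linarith [hσ.2]⟩
    have h5 : B * |ε (σ - S.τφ) - (estimate εstar ξ₀ N εt τ + a * Real.sin (ω * (σ - S.τφ)))|
        ≤ B * (2 * a * ω * δ * Q * (2 * Real.pi / ω + S.Tl)) := by gcongr
    have h6 : B * (a * Real.sin (ω * (σ - S.τφ))) ^ 2 ≤ B * a ^ 2 := by
      gcongr B * ?_
      exact sq_le_sq' hsin'.1 hsin'.2
    refine (abs_sub_le _ (S.costBar M ξ₀ (ε (σ - S.τφ)) N σ) _).trans ?_
    linarith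

/-- Gradient ascent: if, from time `t₀` on, the adaptation law follows the gradient of the
steady-state cost up to the error `κ`, and the estimate stays within `c` of its initial value until
`t₀`, then the estimate never leaves `[3c, ε̄ - 3c]`, and it is within `ν` of the maximiser after an
explicit time. -/
theorem estimate_converges (h : TrappedRun S εbar Nmin M εstar a ω δ N ξ₀ R c T xt εt)
    (hεbar : 0 < εbar)
    (hstar : Differentiable ℝ fun τ => εstar ξ₀ N τ)
    (hac : 2 * a < c)
    {αJ : ℝ → ℝ} {κ ν t₀ : ℝ} (hαJ : ClassK αJ) (hν : 0 < ν) (hνc : ν ≤ c)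
    (hgrad : ∀ ε ∈ Ioc 0 εbar, ∀ τ,
      derivWithin (fun ε => S.costBar M ξ₀ ε N τ) (Ioc 0 εbar) ε * (ε - εstar ξ₀ N τ)
        ≤ -αJ |ε - εstar ξ₀ N τ|)
    (hrange : ∀ τ, εstar ξ₀ N τ ∈ Icc (4 * c) (εbar - 4 * c))
    (hslow : ∀ τ, |deriv (fun τ => εstar ξ₀ N τ) τ| ≤ a ^ 2 * ω * δ * κ)
    (hκ0 : 0 < κ) (hκ : 3 * κ * εbar ≤ αJ ν)
    (ht₀ : 0 ≤ t₀)
    (hinit : estimate εstar ξ₀ N εt 0 ∈ Icc (4 * c) (εbar - 4 * c))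
    (hdrift : ∀ τ ∈ Icc 0 T, τ ≤ t₀ →
      |estimate εstar ξ₀ N εt τ - estimate εstar ξ₀ N εt 0| ≤ c)
    (had : ∀ τ ∈ Icc t₀ T,
      |S.adaptation M ξ₀ a ω δ N xt (scanRate εstar ξ₀ a ω N εt) τ
        - a ^ 2 * ω * δ * derivWithin (fun ε => S.costBar M ξ₀ ε N τ) (Ioc 0 εbar)
          (estimate εstar ξ₀ N εt τ)| ≤ a ^ 2 * ω * δ * κ) :
    ∀ τ ∈ Icc 0 T, estimate εstar ξ₀ N εt τ ∈ Icc (3 * c) (εbar - 3 * c) ∧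
      (t₀ + εbar / (a ^ 2 * ω * δ * κ) ≤ τ → |εt τ| ≤ ν) := by
  have ha := h.a_pos
  have hω := h.ω_pos
  have hδ := h.δ_pos
  set k := a ^ 2 * ω * δ with hk
  have hkpos : 0 < k := by positivity
  have hm : 0 < k * κ := by positivity
  set G := S.adaptation M ξ₀ a ω δ N xt (scanRate εstar ξ₀ a ω N εt) with hG
  have het : ∀ τ, εt τ = estimate εstar ξ₀ N εt τ - εstar ξ₀ N τ := fun τ => by
    unfold estimate; ring
  have habs : ∀ τ ∈ Icc 0 T, |εt τ| ≤ εbar := fun τ hτ => by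
    have h1 := h.estimate_mem hac τ hτ
    have h2 := hrange τ
    rw [het]
    exact abs_le.2 ⟨by linarith [h1.1, h2.2], by linarith [h1.2, h2.1]⟩
  have hαν : ∀ {s}, ν ≤ s → αJ ν ≤ αJ s := fun hs =>
    hαJ.strictMonoOn.monotoneOn hν.le (hν.le.trans hs) hs
  -- far from the maximiser the adaptation law points towards it
  have hup : ∀ τ ∈ Icc t₀ T, ν ≤ εt τ → G τ ≤ -(2 * (k * κ)) := by
    intro τ hτ hντ
    have hτ0 : τ ∈ Icc 0 T := ⟨ht₀.trans hτ.1, hτ.2⟩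
    have h1 := h.estimate_mem hac τ hτ0
    have h2 := hgrad (estimate εstar ξ₀ N εt τ) ⟨by linarith [h1.1], by linarith [h1.2]⟩ τ
    have h3 := hαν (hντ.trans (le_abs_self _))
    have h4 := (abs_le.1 (habs τ hτ0)).2
    rw [← het] at h2
    set D := derivWithin (fun ε => S.costBar M ξ₀ ε N τ) (Ioc 0 εbar) (estimate εstar ξ₀ N εt τ)
      with hD
    have h5 : D ≤ -(3 * κ) := by
      by_contra! hlt
      nlinarith
    have h6 := (abs_le.1 (had τ hτ)).2
    rw [← hD] at h6
    nlinarith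
  have hdown : ∀ τ ∈ Icc t₀ T, ν ≤ -εt τ → 2 * (k * κ) ≤ G τ := by
    intro τ hτ hντ
    have hτ0 : τ ∈ Icc 0 T := ⟨ht₀.trans hτ.1, hτ.2⟩
    have h1 := h.estimate_mem hac τ hτ0
    have h2 := hgrad (estimate εstar ξ₀ N εt τ) ⟨by linarith [h1.1], by linarith [h1.2]⟩ τ
    have h3 := hαν (hντ.trans (neg_le_abs _))
    have h4 := (abs_le.1 (habs τ hτ0)).1
    rw [← het] at h2
    set D := derivWithin (fun ε => S.costBar M ξ₀ ε N τ) (Ioc 0 εbar) (estimate εstar ξ₀ N εt τ)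
      with hD
    have h5 : 3 * κ ≤ D := by
      by_contra! hlt
      nlinarith
    have h6 := (abs_le.1 (had τ hτ)).1
    rw [← hD] at h6
    nlinarith
  have hsub : Icc t₀ T ⊆ Icc 0 T := Icc_subset_Icc_left ht₀
  have hright : ∀ τ ∈ Ico t₀ T, HasDerivWithinAt (estimate εstar ξ₀ N εt) (G τ) (Ici τ) τ :=
    fun τ hτ => (h.deriv_ε τ (hsub (Ico_subset_Icc_self hτ))).mono_of_mem_nhdsWithin
      (mem_of_superset (Icc_mem_nhdsGE hτ.2) (Icc_subset_Icc_left (ht₀.trans hτ.1)))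
  have hcont : ContinuousOn (estimate εstar ξ₀ N εt) (Icc t₀ T) := fun τ hτ =>
    ((h.deriv_ε τ (hsub hτ)).continuousWithinAt).mono hsub
  have hrightt : ∀ τ ∈ Ico t₀ T,
      HasDerivWithinAt εt (G τ - deriv (fun τ => εstar ξ₀ N τ) τ) (Ici τ) τ := fun τ hτ => by
    have := (hright τ hτ).sub (hstar τ).hasDerivAt.hasDerivWithinAt
    exact this.congr (fun s _ => het s) (het τ)
  have hcontt : ContinuousOn εt (Icc t₀ T) :=
    (hcont.sub hstar.continuous.continuousOn).congr fun τ _ => het τ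
  intro τ hτ
  rcases le_or_gt τ t₀ with hle | hlt
  · have h1 := abs_le.1 (hdrift τ hτ hle)
    refine ⟨⟨by linarith [hinit.1], by linarith [hinit.2]⟩, fun h2 => ?_⟩
    have : 0 < εbar / (k * κ) := by positivity
    linarith
  · have hτ' : τ ∈ Icc t₀ T := ⟨hlt.le, hτ.2⟩
    have ht₀' : t₀ ∈ Icc 0 T := ⟨ht₀, hlt.le.trans hτ.2⟩
    have hd0 := abs_le.1 (hdrift t₀ ht₀' le_rfl)
    have e0 := abs_le.1 (habs t₀ ht₀')
    have hpos : 0 ≤ k * κ * (τ - t₀) := mul_nonneg hm.le (by linarith)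
    refine ⟨⟨?_, ?_⟩, fun hge => ?_⟩
    · have h1 := le_max_of_deriv_le_neg (v := fun s => -estimate εstar ξ₀ N εt s)
        (v' := fun s => -G s) (b := -(3 * c)) hm hcont.neg (fun s hs => (hright s hs).neg)
        (fun s hs hb => by
          have := hdown s (Ico_subset_Icc_self hs) (by rw [het]; linarith [(hrange s).1])
          linarith) τ hτ'
      rcases le_max_iff.1 h1 with h2 | h2 <;> linarith [hinit.1]
    · have h1 := le_max_of_deriv_le_neg (v := fun s => estimate εstar ξ₀ N εt s)
        (v' := fun s => G s) (b := εbar - 3 * c) hm hcont (fun s hs => hright s hs)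
        (fun s hs hb => by
          have := hup s (Ico_subset_Icc_self hs) (by rw [het]; linarith [(hrange s).2])
          linarith) τ hτ'
      rcases le_max_iff.1 h1 with h2 | h2 <;> linarith [hinit.2]
    · have htime : εbar ≤ k * κ * (τ - t₀) := by
        rw [mul_comm, ← div_le_iff₀ hm]; linarith
      rw [abs_le]
      constructor
      · have h1 := le_max_of_deriv_le_neg (v := fun s => -εt s)
          (v' := fun s => -(G s - deriv (fun τ => εstar ξ₀ N τ) s)) (b := ν) hm hcontt.neg
          (fun s hs => (hrightt s hs).neg)
          (fun s hs hb => by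
            have := hdown s (Ico_subset_Icc_self hs) hb
            have := (abs_le.1 (hslow s)).2
            linarith) τ hτ'
        rcases le_max_iff.1 h1 with h2 | h2 <;> linarith
      · have h1 := le_max_of_deriv_le_neg (v := fun s => εt s)
          (v' := fun s => G s - deriv (fun τ => εstar ξ₀ N τ) s) (b := ν) hm hcontt
          (fun s hs => hrightt s hs)
          (fun s hs hb => by
            have := hup s (Ico_subset_Icc_self hs) hb
            have := (abs_le.1 (hslow s)).1
            linarith) τ hτ'
        rcases le_max_iff.1 h1 with h2 | h2 <;> linarith

end TrappedRun
end AFM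

/-! ### Choice of the gains -/

theorem exists_pos_forall_mul_le (A : ℝ) {b : ℝ} (hb : 0 < b) :
    ∃ t > 0, ∀ s ∈ Ioo 0 t, A * s ≤ b := by
  refine ⟨b / (|A| + 1), by positivity, fun s hs => ?_⟩
  have h1 := (lt_div_iff₀ (by positivity)).1 hs.2
  nlinarith [mul_le_mul_of_nonneg_right (le_abs_self A) hs.1.le, hs.1]

theorem exists_pos_forall_div_le (A : ℝ) {b : ℝ} (hb : 0 < b) :
    ∃ t > 0, ∀ s > t, A / s ≤ b := by
  refine ⟨|A| / b + 1, by positivity, fun s hs => ?_⟩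
  have hs0 : 0 < s := lt_trans (by positivity) hs
  rw [div_le_iff₀ hs0]
  have h1 : |A| / b < s := by linarith
  rw [div_lt_iff₀ hb] at h1
  linarith [le_abs_self A]

theorem ClassK.pos {α : ℝ → ℝ} (h : ClassK α) {r : ℝ} (hr : 0 < r) : 0 < α r := by
  have := h.strictMonoOn (mem_Ici.2 le_rfl) (mem_Ici.2 hr.le) hr
  rwa [h.map_zero] at this

theorem ClassK.exists_pos_lt {α : ℝ → ℝ} (h : ClassK α) {b : ℝ} (hb : 0 < b) :
    ∃ r > 0, α r < b := by
  have h1 : Tendsto α (𝓝[>] 0) (𝓝 0) := by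
    have := (h.continuousOn 0 self_mem_Ici).mono Ioi_subset_Ici_self
    rwa [ContinuousWithinAt, h.map_zero] at this
  obtain ⟨r, hr, hr0⟩ := ((h1.eventually (gt_mem_nhds hb)).and self_mem_nhdsWithin).exists
  exact ⟨r, hr0, hr⟩

namespace AFM

variable {nr no nc nzo nzc : ℕ}

/-- The choice of the gains. For a small dither amplitude, then a low dither frequency, then a low
adaptation gain, then many lines, every run that stays in the trapping region satisfies the defining
inequalities of the region strictly, and has converged after a uniform time. -/
theorem exists_gains (S : AFM nr no nc nzo nzc) {εbar Nmin : ℝ} (hεbar : 0 < εbar)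
    (hNmin : 0 < Nmin) {M : EuclideanSpace ℝ (Fin nr) → ℝ → ℝ → State no nc nzo nzc}
    {εstar : EuclideanSpace ℝ (Fin nr) → ℝ → ℝ → ℝ}
    (hreg : S.Regular εbar Nmin) (hexo : S.ExosystemAssumption Nmin)
    (htop : S.TopographyAssumption) (hss : S.SteadyStateAssumption εbar Nmin M)
    (hcost : S.CostAssumption εbar Nmin M εstar)
    (hslow : S.SlowVariationAssumption εbar Nmin M εstar)
    {ρx0 νεp νx νε : ℝ} (hρx0 : 0 < ρx0) (hνεp : νεp ∈ Ioo 0 (εbar / 2))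
    (hνx : 0 < νx) (hνε : 0 < νε) :
    ∃ R > ρx0, ∃ c > 0, c < νεp ∧ ∃ astar > 0, ∀ a ∈ Ioo 0 astar,
    ∃ ωstar > 0, ∀ ω ∈ Ioo 0 ωstar, ∃ δstar > 0, ∀ δ ∈ Ioo 0 δstar,
    ∃ Nstar > 0, Nmin ≤ Nstar ∧ ∀ N > Nstar, ∃ T₁ : ℝ,
    ∀ (ξ₀ : EuclideanSpace ℝ (Fin nr)) (T : ℝ) (xt : ℝ → State no nc nzo nzc) (εt : ℝ → ℝ),
      TrappedRun S εbar Nmin M εstar a ω δ N ξ₀ R c T xt εt → ‖xt 0‖ ≤ ρx0 →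
      estimate εstar ξ₀ N εt 0 ∈ Icc νεp (εbar - νεp) →
      ∀ τ ∈ Icc 0 T, ‖xt τ‖ < R ∧ scanRate εstar ξ₀ a ω N εt τ ∈ Ioo c (εbar - c) ∧
        |εt τ| ≤ εbar ∧ (T₁ ≤ τ → ‖xt τ‖ ≤ νx ∧ |εt τ| ≤ νε) := by
  obtain ⟨α₁, α₂, αf, V, hα₁, hα₂, hαf, hVs, hVb, hV⟩ := hss.lyapunov
  obtain ⟨εlo, hlo, εhi, hhi, hrange⟩ := hcost.range
  obtain ⟨αJ, hαJ, hgrad⟩ := hcost.gradient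
  obtain ⟨kε, hkε, hstar⟩ := hslow.star_slow
  obtain ⟨B, hB, kJ, hkJ, hexp⟩ := exists_costBar_expansion hcost hslow
  -- the margin of the scan rate, and the required accuracy of the gradient estimate
  obtain ⟨c, hc, hc1, hc2, hc3⟩ : ∃ c > 0, 4 * c ≤ νεp ∧ 4 * c ≤ εlo ∧ 4 * c ≤ εbar - εhi :=
    ⟨min νεp (min εlo (εbar - εhi)) / 4,
      div_pos (lt_min hνεp.1 (lt_min hlo.1 (sub_pos.2 hhi.2))) (by norm_num),
      by linarith [min_le_left νεp (min εlo (εbar - εhi))],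
      by linarith [min_le_right νεp (min εlo (εbar - εhi)), min_le_left εlo (εbar - εhi)],
      by linarith [min_le_right νεp (min εlo (εbar - εhi)), min_le_right εlo (εbar - εhi)]⟩
  obtain ⟨ν, hν, hν1, hν2⟩ : ∃ ν > 0, ν ≤ νε ∧ ν ≤ c :=
    ⟨min νε c, lt_min hνε hc, min_le_left _ _, min_le_right _ _⟩
  obtain ⟨κ, hκ, hκJ⟩ : ∃ κ > 0, 3 * κ * εbar ≤ αJ ν :=
    ⟨αJ ν / (3 * εbar), div_pos (hαJ.pos hν) (by positivity), le_of_eq (by field_simp)⟩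
  obtain ⟨R, hR⟩ : ∃ R, α₂ ρx0 < α₁ R ∧ ρx0 < R ∧ νx ≤ R :=
    ((hα₁.tendsto_atTop.eventually_gt_atTop (α₂ ρx0)).and
      ((eventually_gt_atTop ρx0).and (eventually_ge_atTop νx))).exists
  obtain ⟨hRα, hRρ, hRν⟩ := hR
  obtain ⟨Q, hQ, hQb⟩ := exists_performance_bound hreg htop hss hexo R
  obtain ⟨Lq, hLq, hperf⟩ := exists_performance_sub_costBar_le hreg htop hss hexo R hc
  obtain ⟨LM, hLM, hM⟩ := hss.exists_lipschitz hc
  obtain ⟨BV, hBV⟩ := hVb R c hc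
  have hTl := hreg.Tl_pos
  -- amplitude: the second-order term of the averaged cost is small
  obtain ⟨a₁, ha₁, ha₁'⟩ := exists_pos_forall_mul_le B (b := κ / 8) (by positivity)
  refine ⟨R, hRρ, c, hc, by linarith, min (c / 2) a₁, lt_min (by positivity) ha₁, fun a ha => ?_⟩
  obtain ⟨ha0, ha'⟩ := ha
  have hac : 2 * a < c := by linarith [lt_min_iff.1 ha']
  have hBa := ha₁' a ⟨ha0, (lt_min_iff.1 ha').2⟩
  -- target accuracy of the plant, fine enough for the gradient estimate
  obtain ⟨η, hη, hη1, hη2⟩ : ∃ η > 0, η ≤ νx ∧ Lq * η ≤ a * κ / 16 := by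
    refine ⟨min νx (a * κ / (16 * Lq)), lt_min hνx (by positivity), min_le_left _ _, ?_⟩
    calc _ ≤ Lq * (a * κ / (16 * Lq)) := by gcongr; exact min_le_right _ _
      _ = _ := by field_simp
  obtain ⟨r, hr, hrη⟩ := hα₂.toClassK.exists_pos_lt (hα₁.toClassK.pos hη)
  have hαfr := hαf.pos hr
  -- frequency: the dither is slow compared with the plant
  obtain ⟨ω₁, hω₁, hω₁'⟩ := exists_pos_forall_mul_le (|BV| * (1 + LM) * (a * (1 + 2 * Q)))
    (b := αf r / 2) (by positivity)
  obtain ⟨ω₂, hω₂, hω₂'⟩ := exists_pos_forall_mul_le (Lq * (a * (1 + 2 * Q) * S.Tl))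
    (b := a * κ / 16) (by positivity)
  refine ⟨min ω₁ ω₂, lt_min hω₁ hω₂, fun ω hω => ?_⟩
  obtain ⟨hω0, hω'⟩ := hω
  have hωV := hω₁' ω ⟨hω0, (lt_min_iff.1 hω').1⟩
  have hωq := hω₂' ω ⟨hω0, (lt_min_iff.1 hω').2⟩
  have hper : 0 < 2 * Real.pi / ω := by positivity
  -- after the time `t₀` a whole history lies beyond the transient of the plant
  set t₀ := 2 * α₂ ρx0 / αf r + S.histLength ω with ht₀
  have htx : 0 < 2 * α₂ ρx0 / αf r := div_pos (by linarith [hα₂.toClassK.pos hρx0]) hαfr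
  have hhist : S.histLength ω = S.Tl + 2 * Real.pi / ω := rfl
  have ht₀pos : 0 < t₀ := by rw [ht₀, hhist]; linarith
  -- adaptation gain: the estimate hardly moves during the transient and over a period
  obtain ⟨δ₁, hδ₁, hδ₁'⟩ := exists_pos_forall_mul_le (2 * a * ω * Q * t₀) hc
  obtain ⟨δ₂, hδ₂, hδ₂'⟩ := exists_pos_forall_mul_le
    (B * (2 * a * ω * Q * (2 * Real.pi / ω + S.Tl))) (b := a * κ / 8) (by positivity)
  refine ⟨min 1 (min δ₁ δ₂), lt_min one_pos (lt_min hδ₁ hδ₂), fun δ hδ => ?_⟩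
  obtain ⟨hδ0, hδ'⟩ := hδ
  obtain ⟨hδ1, hδ'⟩ := lt_min_iff.1 hδ'
  have hδt := hδ₁' δ ⟨hδ0, (lt_min_iff.1 hδ').1⟩
  have hδp := hδ₂' δ ⟨hδ0, (lt_min_iff.1 hδ').2⟩
  -- number of lines: cost and maximiser drift slowly compared with the adaptation
  obtain ⟨N₁, hN₁, hN₁'⟩ := exists_pos_forall_div_le (kJ * (2 * Real.pi / ω)) (b := a * κ / 8)
    (by positivity)
  obtain ⟨N₂, hN₂, hN₂'⟩ := exists_pos_forall_div_le kε (b := a ^ 2 * ω * δ * κ) (by positivity)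
  refine ⟨max Nmin (max N₁ N₂), lt_max_of_lt_left hNmin, le_max_left _ _, fun N hN => ?_⟩
  obtain ⟨hN0, hN⟩ := max_lt_iff.1 hN
  have hNJ := hN₁' N (max_lt_iff.1 hN).1
  have hNε := hN₂' N (max_lt_iff.1 hN).2
  refine ⟨t₀ + εbar / (a ^ 2 * ω * δ * κ), fun ξ₀ T xt εt h hx0 hε0 => ?_⟩
  have hξ := h.mem_Dr
  have hsubh : ∀ σ ∈ Icc (-(2 * Real.pi / ω)) T, Icc (σ - S.Tl) σ ⊆ Icc (-S.histLength ω) T :=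
    fun σ hσ => Icc_subset_Icc (by rw [hhist]; linarith [hσ.1]) hσ.2
  have hperfQ : ∀ σ ∈ Icc (-(2 * Real.pi / ω)) T,
      |S.performance M ξ₀ N xt (scanRate εstar ξ₀ a ω N εt) σ| ≤ Q := fun σ hσ =>
    hQb N hN0.le ξ₀ hξ xt _ σ (h.continuousOn_x.mono (hsubh σ hσ))
      (h.continuousOn_ε.mono (hsubh σ hσ)) fun s hs =>
        ⟨h.bound_x s (hsubh σ hσ hs), h.range s (hsubh σ hσ hs)⟩
  have hcIcc : ∀ t ∈ Icc 0 T, scanRate εstar ξ₀ a ω N εt t ∈ Icc c εbar := fun t ht =>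
    ⟨(h.margin t ht).1, by linarith [(h.margin t ht).2]⟩
  have hcIoc : ∀ t ∈ Icc 0 T, scanRate εstar ξ₀ a ω N εt t ∈ Ioc 0 εbar := fun t ht =>
    ⟨hc.trans_le (hcIcc t ht).1, (hcIcc t ht).2⟩
  have hsub0 : Icc 0 T ⊆ Icc (-S.histLength ω) T :=
    Icc_subset_Icc_left (by rw [hhist]; linarith)
  have hδQ : a * ω * (1 + 2 * δ * Q) ≤ a * ω * (1 + 2 * Q) := by
    have := mul_le_of_le_one_left hQ.le hδ1.le
    exact mul_le_mul_of_nonneg_left (by linarith only [this]) (mul_pos ha0 hω0).le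
  have hlyap := lyapunov_slow_parameter (V := fun y p => V y p N) (x := xt)
    (e := scanRate εstar ξ₀ a ω N εt) (B := |BV|) (D := LM) (μ := a * ω * (1 + 2 * δ * Q))
    (T := T) hα₁.toClassK hα₂.toClassK hαf
    ((hVs N hN0.le).differentiableOn (by norm_num)) (uniqueDiffOn_Ioc _ _)
    (fun y p hp => (hV N hN0.le p hp y).1) (fun y p hp => (hV N hN0.le p hp y).2.1)
    hr hη (hη1.trans hRν) hx0 hRα hrη h.deriv_x h.hasDerivWithinAt_scanRate hcIoc
    (fun t ht => (hV N hN0.le _ (hcIoc t ht) (xt t)).2.2 ξ₀ hξ t ht.1) (abs_nonneg _)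
    (fun t ht => by
      have := hBV N hN0.le (xt t) (h.bound_x t (hsub0 ht)) _ (hcIcc t ht)
      exact ⟨this.1.trans (le_abs_self _), this.2.trans (le_abs_self _)⟩)
    (fun t ht => (hM N hN0.le _ (hexo.invariant N hN0.le ξ₀ hξ t)).1 _ (hcIcc t ht))
    (h.abs_deriv_scanRate_le hperfQ) (by
      calc _ ≤ |BV| * (1 + LM) * (a * ω * (1 + 2 * Q)) := by gcongr
        _ ≤ _ := by linarith)
  have hgradient := h.abs_adaptation_sub_gradient_le hreg htop hss hexo hNmin hac
    (t₀ := 2 * α₂ ρx0 / αf r) (κ := κ) htx.le (hη1.trans hRν) hB hkJ hQ hperfQ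
    (hperf N hN0.le ξ₀ hξ) (hexp N hN0.le ξ₀ hξ)
    (fun s hs => ((hlyap s ⟨htx.le.trans hs.1, hs.2⟩).2 hs.1).le) (by
      have e1 : Lq * (a * ω * (1 + 2 * δ * Q) * S.Tl) ≤ Lq * (a * ω * (1 + 2 * Q) * S.Tl) := by
        gcongr
      have e2 : kJ / N * (2 * Real.pi / ω) = kJ * (2 * Real.pi / ω) / N := by ring
      have e3 : B * a ^ 2 ≤ a * κ / 8 := by
        calc B * a ^ 2 = B * a * a := by ring
          _ ≤ κ / 8 * a := by gcongr
          _ = a * κ / 8 := by ring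
      rw [e2]
      linarith)
  have hest := h.estimate_converges hεbar
    ((hslow.star_smooth N hN0.le ξ₀ hξ).differentiable (by norm_num)) hac (κ := κ) (ν := ν)
    (t₀ := t₀) hαJ hν hν2 (hgrad N hN0.le ξ₀ hξ)
    (fun τ => ⟨by linarith [(hrange N hN0 ξ₀ hξ τ).1], by linarith [(hrange N hN0 ξ₀ hξ τ).2]⟩)
    (fun τ => (hstar N hN0.le ξ₀ hξ τ).trans hNε) hκ hκJ ht₀pos.le
    ⟨by linarith [hε0.1], by linarith [hε0.2]⟩
    (fun τ hτ hle => by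
      refine (h.abs_estimate_sub_le hperfQ hτ ⟨le_rfl, hτ.1.trans hτ.2⟩).trans ?_
      rw [sub_zero, abs_of_nonneg hτ.1]
      calc _ ≤ 2 * a * ω * δ * Q * t₀ := by gcongr
        _ ≤ c := by linarith)
    hgradient
  intro τ hτ
  have h1 := hlyap τ hτ
  have h2 := hest τ hτ
  have h3 : |a * Real.sin (ω * τ)| ≤ a := by
    rw [abs_mul, abs_of_pos ha0]
    exact mul_le_of_le_one_right ha0.le (Real.abs_sin_le_one _)
  have h4 := abs_le.1 h3
  refine ⟨h1.1, ⟨?_, ?_⟩, ?_, fun hle => ⟨(h1.2 ?_).le.trans hη1, (h2.2 hle).trans hν1⟩⟩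
  · unfold scanRate; linarith [h2.1.1]
  · unfold scanRate; linarith [h2.1.2]
  · have h5 := h.estimate_mem hac τ hτ
    have h6 := hrange N hN0 ξ₀ hξ τ
    have h7 : εt τ = estimate εstar ξ₀ N εt τ - εstar ξ₀ N τ := by unfold estimate; ring
    rw [h7, abs_le]
    constructor <;> linarith [h5.1, h5.2, h6.1, h6.2]
  · have : 0 < εbar / (a ^ 2 * ω * δ * κ) := by positivity
    rw [ht₀, hhist] at hle
    linarith

end AFM

/-! ### The closed loop with cutoffs -/

/-- Radial retraction of a normed space onto the closed ball of radius `K`. -/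
noncomputable def radialRetraction {X : Type*} [NormedAddCommGroup X] [NormedSpace ℝ X] (K : ℝ)
    (x : X) : X := (K / max K ‖x‖) • x

section radialRetraction

variable {X : Type*} [NormedAddCommGroup X] [NormedSpace ℝ X] {K : ℝ}

theorem norm_radialRetraction_le (hK : 0 < K) (x : X) : ‖radialRetraction K x‖ ≤ K := by
  have hm : 0 < max K ‖x‖ := lt_max_of_lt_left hK
  rw [radialRetraction, norm_smul, Real.norm_eq_abs, abs_of_pos (by positivity), div_mul_eq_mul_div,
    div_le_iff₀ hm]
  gcongr
  exact le_max_right _ _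

theorem radialRetraction_of_norm_le (hK : 0 < K) {x : X} (hx : ‖x‖ ≤ K) :
    radialRetraction K x = x := by
  rw [radialRetraction, max_eq_left hx, div_self hK.ne', one_smul]

theorem norm_radialRetraction_sub_le (hK : 0 < K) (x y : X) :
    ‖radialRetraction K x - radialRetraction K y‖ ≤ 2 * ‖x - y‖ := by
  have hx : 0 < max K ‖x‖ := lt_max_of_lt_left hK
  have hy : 0 < max K ‖y‖ := lt_max_of_lt_left hK
  have h1 : radialRetraction K x - radialRetraction K y
      = (K / max K ‖x‖) • (x - y) + (K / max K ‖x‖ - K / max K ‖y‖) • y := by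
    unfold radialRetraction; module
  have h2 : ‖(K / max K ‖x‖) • (x - y)‖ ≤ ‖x - y‖ := by
    rw [norm_smul, Real.norm_eq_abs, abs_of_pos (by positivity)]
    exact mul_le_of_le_one_left (norm_nonneg _) ((div_le_one hx).2 (le_max_left _ _))
  have h3 : ‖(K / max K ‖x‖ - K / max K ‖y‖) • y‖ ≤ ‖x - y‖ := by
    have e : K / max K ‖x‖ - K / max K ‖y‖
        = K / max K ‖x‖ * ((max K ‖y‖ - max K ‖x‖) / max K ‖y‖) := by field_simp
    rw [norm_smul, e, Real.norm_eq_abs, abs_mul, abs_of_pos (div_pos hK hx), abs_div,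
      abs_of_pos hy]
    have h4 : |max K ‖y‖ - max K ‖x‖| ≤ ‖x - y‖ := by
      rw [abs_sub_comm]
      have h := abs_max_sub_max_le_max K ‖x‖ K ‖y‖
      rw [sub_self, abs_zero, max_eq_right (abs_nonneg (‖x‖ - ‖y‖))] at h
      exact h.trans (abs_norm_sub_norm_le x y)
    calc _ ≤ 1 * (‖x - y‖ / max K ‖y‖) * max K ‖y‖ := by
          gcongr
          · exact (div_le_one hx).2 (le_max_left _ _)
          · exact le_max_right _ _
      _ = ‖x - y‖ := by field_simp
  rw [h1]
  linarith [norm_add_le ((K / max K ‖x‖) • (x - y)) ((K / max K ‖x‖ - K / max K ‖y‖) • y)]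

theorem continuous_radialRetraction (hK : 0 < K) : Continuous (radialRetraction K : X → X) := by
  unfold radialRetraction
  refine (continuous_const.div (by fun_prop) fun x => ?_).smul continuous_id
  exact (lt_max_of_lt_left hK).ne'

end radialRetraction

/-- Projection of the real line onto `[c, d]`. -/
noncomputable def clamp (c d e : ℝ) : ℝ := max c (min d e)

theorem continuous_clamp (c d : ℝ) : Continuous (clamp c d) := by
  unfold clamp; fun_prop

theorem clamp_mem {c d : ℝ} (h : c ≤ d) (e : ℝ) : clamp c d e ∈ Icc c d :=
  ⟨le_max_left _ _, max_le h (min_le_left _ _)⟩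

theorem clamp_of_mem {c d e : ℝ} (h : e ∈ Icc c d) : clamp c d e = e := by
  rw [clamp, min_eq_right h.2, max_eq_right h.1]

theorem abs_clamp_sub_le (c d x y : ℝ) : |clamp c d x - clamp c d y| ≤ |x - y| := by
  have h1 := abs_max_sub_max_le_max c (min d x) c (min d y)
  have h2 := abs_min_sub_min_le_max d x d y
  rw [sub_self, abs_zero, max_eq_right (abs_nonneg (min d x - min d y))] at h1
  rw [sub_self, abs_zero, max_eq_right (abs_nonneg (x - y))] at h2
  exact h1.trans h2

theorem continuous_integral_window {g : ℝ → ℝ} (hg : Continuous g) (p : ℝ) :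
    Continuous fun t => ∫ s in (t - p)..t, g s := by
  have h : ∀ t, ∫ s in (t - p)..t, g s = (∫ s in (0 : ℝ)..t, g s) - ∫ s in (0 : ℝ)..(t - p), g s :=
    fun t => (intervalIntegral.integral_interval_sub_left (hg.intervalIntegrable _ _)
      (hg.intervalIntegrable _ _)).symm
  simp_rw [h]
  have h1 := intervalIntegral.continuous_primitive (μ := volume) (fun a b => hg.intervalIntegrable a b) 0
  exact h1.sub (h1.comp (by fun_prop))

namespace AFM

variable {nr no nc nzo nzc : ℕ} (S : AFM nr no nc nzo nzc)

theorem lineError_congr (hT : 0 < S.Tl) {e₁ e₂ : ℝ → ℝ} {τ : ℝ}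
    (h : EqOn e₁ e₂ (Icc (τ - S.Tl) τ)) : S.lineError e₁ τ = S.lineError e₂ τ := by
  unfold lineError
  split_ifs
  · congr 1
    exact image_congr fun s hs => by rw [h hs]
  · congr 2
    refine intervalIntegral.integral_congr fun s hs => ?_
    rw [uIcc_of_le (by linarith)] at hs
    simp only [h hs]

/-- The performance output as a functional of the plant state and the estimate, with the state and
the scan rate cut off to compact sets. -/
noncomputable def cutoffPerformance (K εbar a ω : ℝ) (y : ℝ → State no nc nzo nzc × ℝ) (σ : ℝ) : ℝ :=
  S.ge (S.lineError (fun s => S.hz (radialRetraction K (y s).1)) σ)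
    + S.gs (clamp 0 εbar ((y (σ - S.τφ)).2 + a * Real.sin (ω * (σ - S.τφ))))

/-- The closed loop in the variables plant state and estimate, with state and scan rate cut off to
compact sets, so that the right-hand side is bounded and globally Lipschitz. -/
noncomputable def cutoffField (K c εbar a ω δ N : ℝ) (ξ₀ : EuclideanSpace ℝ (Fin nr)) (t : ℝ)
    (y : ℝ → State no nc nzo nzc × ℝ) : State no nc nzo nzc × ℝ :=
  (S.f (radialRetraction K (y t).1) (S.exo N ξ₀ t)
      (clamp c (εbar - c) ((y t).2 + a * Real.sin (ω * t))) N,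
    a * ω ^ 2 * δ / Real.pi * ∫ σ in (t - 2 * Real.pi / ω)..t,
      S.cutoffPerformance K εbar a ω y σ * Real.sin (ω * (σ - S.τφ)))

variable {S} {εbar Nmin : ℝ}

theorem continuous_cutoffPerformance (hreg : S.Regular εbar Nmin) (htop : S.TopographyAssumption)
    {K a ω : ℝ} (hK : 0 < K) {y : ℝ → State no nc nzo nzc × ℝ} (hy : Continuous y) :
    Continuous (S.cutoffPerformance K εbar a ω y) := by
  have h1 := S.continuous_lineError hreg.Tl_pos hreg.one_le_p
    ((S.contDiff_hz htop).continuous.comp ((continuous_radialRetraction hK).comp hy.fst))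
  refine (hreg.ge_smooth.continuous.comp h1).add (hreg.gs_smooth.continuous.comp
    ((continuous_clamp 0 εbar).comp ?_))
  fun_prop

theorem exists_cutoffPerformance_bound (hreg : S.Regular εbar Nmin) (htop : S.TopographyAssumption)
    (hεbar : 0 < εbar) {K : ℝ} (hK : 0 < K) (a ω : ℝ) :
    ∃ Q L, 0 ≤ Q ∧ 0 ≤ L ∧ ∀ y : ℝ → State no nc nzo nzc × ℝ, Continuous y →
      (∀ σ, |S.cutoffPerformance K εbar a ω y σ| ≤ Q) ∧
      ∀ z : ℝ → State no nc nzo nzc × ℝ, Continuous z → ∀ σ d, (∀ s ≤ σ, ‖y s - z s‖ ≤ d) →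
        |S.cutoffPerformance K εbar a ω y σ - S.cutoffPerformance K εbar a ω z σ| ≤ L * d := by
  obtain ⟨H, hH0, hH⟩ := exists_hz_bound htop K
  obtain ⟨Lh, hLh0, hLh⟩ := exists_hz_lipschitz htop K
  obtain ⟨G, hG⟩ := (isCompact_Icc (a := -H) (b := H)).exists_bound_of_continuousOn
    hreg.ge_smooth.continuous.continuousOn
  obtain ⟨G', hG'⟩ := (isCompact_Icc (a := 0) (b := εbar)).exists_bound_of_continuousOn
    hreg.gs_smooth.continuous.continuousOn
  obtain ⟨Le, hLe0, hLe⟩ := hreg.ge_smooth.contDiffOn.exists_lipschitz_of_convex_isCompact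
    (convex_Icc (-H) H) isCompact_Icc
  obtain ⟨Ls, hLs0, hLs⟩ := hreg.gs_smooth.contDiffOn.exists_lipschitz_of_convex_isCompact
    (convex_Icc 0 εbar) isCompact_Icc
  have hcont : ∀ {y : ℝ → State no nc nzo nzc × ℝ}, Continuous y →
      Continuous fun s => S.hz (radialRetraction K (y s).1) := fun hy =>
    (S.contDiff_hz htop).continuous.comp ((continuous_radialRetraction hK).comp hy.fst)
  have hline : ∀ {y : ℝ → State no nc nzo nzc × ℝ}, Continuous y → ∀ σ,
      S.lineError (fun s => S.hz (radialRetraction K (y s).1)) σ ∈ Icc (-H) H := fun hy σ =>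
    abs_le.1 (S.abs_lineError_le hreg.Tl_pos hreg.one_le_p (hcont hy).continuousOn
      fun s _ => hH _ (norm_radialRetraction_le hK _))
  refine ⟨|G| + |G'|, Le * (Lh * 2) + Ls, by positivity, by positivity, fun y hy =>
    ⟨fun σ => ?_, fun z hz σ d hd => ?_⟩⟩
  · exact (abs_add_le _ _).trans (add_le_add ((hG _ (hline hy σ)).trans (le_abs_self _))
      ((hG' _ (clamp_mem hεbar.le _)).trans (le_abs_self _)))
  · have h1 := S.abs_lineError_sub_le hreg.Tl_pos hreg.one_le_p (τ := σ) (η := Lh * (2 * d))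
      (hcont hy).continuousOn (hcont hz).continuousOn fun s hs => by
        refine (hLh _ (norm_radialRetraction_le hK _) _ (norm_radialRetraction_le hK _)).trans ?_
        gcongr
        refine (norm_radialRetraction_sub_le hK _ _).trans ?_
        gcongr
        exact (norm_fst_le (y s - z s)).trans (hd s hs.2)
    have h2 := hLe _ (hline hy σ) _ (hline hz σ)
    have hσ := (delayed_mem hreg σ).2
    have h3 := hLs _ (clamp_mem hεbar.le ((y (σ - S.τφ)).2 + a * Real.sin (ω * (σ - S.τφ))))
      _ (clamp_mem hεbar.le ((z (σ - S.τφ)).2 + a * Real.sin (ω * (σ - S.τφ))))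
    have h4 : |clamp 0 εbar ((y (σ - S.τφ)).2 + a * Real.sin (ω * (σ - S.τφ)))
        - clamp 0 εbar ((z (σ - S.τφ)).2 + a * Real.sin (ω * (σ - S.τφ)))| ≤ d := by
      refine (abs_clamp_sub_le _ _ _ _).trans ?_
      rw [add_sub_add_right_eq_sub]
      exact (norm_snd_le (y (σ - S.τφ) - z (σ - S.τφ))).trans (hd _ hσ)
    simp only [Real.norm_eq_abs] at h2 h3
    unfold cutoffPerformance
    rw [add_sub_add_comm]
    refine (abs_add_le _ _).trans ?_
    calc _ ≤ Le * (Lh * (2 * d)) + Ls * d :=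
          add_le_add (h2.trans (by gcongr)) (h3.trans (by gcongr))
      _ = _ := by ring

/-- The plant vector field with state and scan rate cut off is bounded, and Lipschitz in state and
estimate. -/
theorem exists_cutoff_f_bound (hreg : S.Regular εbar Nmin) (htop : S.TopographyAssumption)
    (hexo : S.ExosystemAssumption Nmin) {K c a ω N : ℝ} (hK : 0 < K)
    (hc : 0 < c) (hcε : 2 * c < εbar) (hN : Nmin ≤ N) (ξ₀ : EuclideanSpace ℝ (Fin nr)) :
    ∃ Kf Lf, 0 ≤ Lf ∧
      (∀ t (u : State no nc nzo nzc × ℝ), ‖S.f (radialRetraction K u.1) (S.exo N ξ₀ t)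
        (clamp c (εbar - c) (u.2 + a * Real.sin (ω * t))) N‖ ≤ Kf) ∧
      (∀ t (u v : State no nc nzo nzc × ℝ),
        ‖S.f (radialRetraction K u.1) (S.exo N ξ₀ t)
          (clamp c (εbar - c) (u.2 + a * Real.sin (ω * t))) N
        - S.f (radialRetraction K v.1) (S.exo N ξ₀ t)
          (clamp c (εbar - c) (v.2 + a * Real.sin (ω * t))) N‖ ≤ Lf * (2 * ‖u - v‖)) ∧
      ∀ y : ℝ → State no nc nzo nzc × ℝ, Continuous y →
        Continuous fun t => S.f (radialRetraction K (y t).1) (S.exo N ξ₀ t)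
          (clamp c (εbar - c) ((y t).2 + a * Real.sin (ω * t))) N := by
  obtain ⟨C, hC⟩ := hexo.neutrally_stable N hN
  have hξ : ∀ t, ‖S.exo N ξ₀ t‖ ≤ C * ‖ξ₀‖ := fun t =>
    (S.exoFlow N t).le_of_opNorm_le (hC t) ξ₀
  set s : Set (State no nc nzo nzc × EuclideanSpace ℝ (Fin nr) × ℝ) :=
    Metric.closedBall 0 K ×ˢ (Metric.closedBall 0 (C * ‖ξ₀‖) ×ˢ Icc c (εbar - c)) with hs
  have hsub : s ⊆ {z | z.2.2 ∈ Ioc 0 εbar} := fun z hz =>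
    ⟨hc.trans_le hz.2.2.1, hz.2.2.2.trans (by linarith)⟩
  have hsc : IsCompact s :=
    (isCompact_closedBall _ _).prod ((isCompact_closedBall _ _).prod isCompact_Icc)
  have hsconv : Convex ℝ s :=
    (convex_closedBall _ _).prod ((convex_closedBall _ _).prod (convex_Icc _ _))
  have hfs := (S.contDiffOn_f hreg htop hN).mono hsub
  obtain ⟨Kf, hKf⟩ : ∃ Kf, ∀ z ∈ s, ‖S.f z.1 z.2.1 z.2.2 N‖ ≤ Kf :=
    hsc.exists_bound_of_continuousOn hfs.continuousOn
  obtain ⟨Lf, hLf0, hLf⟩ := hfs.exists_lipschitz_of_convex_isCompact hsconv hsc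
  have hmem : ∀ t (u : State no nc nzo nzc × ℝ), (radialRetraction K u.1, S.exo N ξ₀ t,
      clamp c (εbar - c) (u.2 + a * Real.sin (ω * t))) ∈ s := fun t u =>
    ⟨by simpa using norm_radialRetraction_le hK u.1, by simpa using hξ t,
      clamp_mem (by linarith) _⟩
  refine ⟨Kf, Lf, hLf0, fun t u => by
    have h := hKf _ (hmem t u)
    exact h, fun t u v => ?_, fun y hy => ?_⟩
  · refine (hLf _ (hmem t u) _ (hmem t v)).trans ?_
    gcongr
    rw [Prod.mk_sub_mk, Prod.mk_sub_mk, Prod.norm_mk, Prod.norm_mk, sub_self, norm_zero,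
      Real.norm_eq_abs]
    have h1 := norm_radialRetraction_sub_le hK u.1 v.1
    have h2 := abs_clamp_sub_le c (εbar - c) (u.2 + a * Real.sin (ω * t))
      (v.2 + a * Real.sin (ω * t))
    rw [add_sub_add_right_eq_sub] at h2
    have h3 := norm_fst_le (u - v)
    have h4 := norm_snd_le (u - v)
    have h5 := norm_nonneg (u - v)
    rw [Prod.fst_sub] at h3
    rw [Prod.snd_sub, Real.norm_eq_abs] at h4
    exact max_le (by linarith) (max_le (by linarith) (by linarith))
  · have h1 : Continuous fun t => (radialRetraction K (y t).1,
        S.exo N ξ₀ t, clamp c (εbar - c) ((y t).2 + a * Real.sin (ω * t))) :=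
      ((continuous_radialRetraction hK).comp hy.fst).prodMk ((S.continuous_exo N ξ₀).prodMk
        ((continuous_clamp _ _).comp (hy.snd.add (by fun_prop))))
    exact hfs.continuousOn.comp_continuous h1 fun t => hmem t (y t)

theorem exists_cutoffField_solution (hreg : S.Regular εbar Nmin) (htop : S.TopographyAssumption)
    (hexo : S.ExosystemAssumption Nmin) (hεbar : 0 < εbar) {K c a ω δ N : ℝ} (hK : 0 < K)
    (hc : 0 < c) (hcε : 2 * c < εbar) (ha : 0 < a) (hω : 0 < ω) (hδ : 0 < δ) (hN : Nmin ≤ N)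
    (ξ₀ : EuclideanSpace ℝ (Fin nr)) {ψ : ℝ → State no nc nzo nzc × ℝ} (hψ : Continuous ψ) :
    ∃ y : ℝ → State no nc nzo nzc × ℝ, Continuous y ∧ (∀ t ≤ 0, y t = ψ t) ∧
      ∀ t ∈ Ici (0 : ℝ),
        HasDerivWithinAt y (S.cutoffField K c εbar a ω δ N ξ₀ t y) (Ici 0) t := by
  obtain ⟨Kf, Lf, hLf0, hfb, hfl, hfc⟩ :=
    exists_cutoff_f_bound hreg htop hexo (a := a) (ω := ω) hK hc hcε hN ξ₀
  obtain ⟨Q, L, hQ0, hL0, hQL⟩ := exists_cutoffPerformance_bound hreg htop hεbar hK a ω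
  have hp : 0 < 2 * Real.pi / ω := by positivity
  set k := a * ω ^ 2 * δ / Real.pi with hk
  have hk0 : 0 < k := by positivity
  have hgc : ∀ y : ℝ → State no nc nzo nzc × ℝ, Continuous y → Continuous fun σ =>
      S.cutoffPerformance K εbar a ω y σ * Real.sin (ω * (σ - S.τφ)) := fun y hy =>
    (continuous_cutoffPerformance hreg htop hK hy).mul (by fun_prop)
  refine exists_solution_of_causal_lipschitz (S.cutoffField K c εbar a ω δ N ξ₀) ψ hψ
    (max Kf (k * (Q * (2 * Real.pi / ω)))) (max (Lf * 2) (k * (L * (2 * Real.pi / ω))))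
    (fun y hy => ?_) (fun t y hy => ?_) (le_max_of_le_left (by positivity))
    (fun t y z d hy hz hd => ?_)
  · have h3 := (continuous_integral_window (hgc y hy) (2 * Real.pi / ω)).const_mul k
    exact (hfc y hy).prodMk h3
  · rw [cutoffField, Prod.norm_mk]
    refine max_le_max (hfb t (y t)) ?_
    have h := intervalIntegral.norm_integral_le_of_norm_le_const (a := t - 2 * Real.pi / ω) (b := t)
      (C := Q) (f := fun σ => S.cutoffPerformance K εbar a ω y σ * Real.sin (ω * (σ - S.τφ)))
      fun σ _ => by
        rw [Real.norm_eq_abs, abs_mul]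
        calc _ ≤ Q * 1 := mul_le_mul ((hQL y hy).1 σ) (Real.abs_sin_le_one _) (abs_nonneg _) hQ0
          _ = Q := mul_one Q
    rw [sub_sub_cancel, abs_of_pos hp] at h
    rw [norm_mul, Real.norm_eq_abs, abs_of_pos hk0]
    gcongr
  · have hd0 : 0 ≤ d := (norm_nonneg _).trans (hd t le_rfl)
    rw [cutoffField, cutoffField, Prod.mk_sub_mk, Prod.norm_mk, max_mul_of_nonneg _ _ hd0]
    refine max_le_max ?_ ?_
    · refine (hfl t (y t) (z t)).trans ?_
      rw [mul_assoc]
      gcongr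
      exact hd t le_rfl
    · rw [← mul_sub, ← intervalIntegral.integral_sub ((hgc y hy).intervalIntegrable _ _)
        ((hgc z hz).intervalIntegrable _ _), norm_mul, Real.norm_eq_abs, abs_of_pos hk0, mul_assoc]
      gcongr
      have h := intervalIntegral.norm_integral_le_of_norm_le_const (a := t - 2 * Real.pi / ω)
        (b := t) (C := L * d) (f := fun σ =>
          S.cutoffPerformance K εbar a ω y σ * Real.sin (ω * (σ - S.τφ))
          - S.cutoffPerformance K εbar a ω z σ * Real.sin (ω * (σ - S.τφ))) fun σ hσ => by
          rw [uIoc_of_le (by linarith)] at hσ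
          rw [← sub_mul, Real.norm_eq_abs, abs_mul]
          calc _ ≤ L * d * 1 := mul_le_mul
                ((hQL y hy).2 z hz σ d fun s hs => hd s (hs.trans hσ.2))
                (Real.abs_sin_le_one _) (abs_nonneg _) (by positivity)
            _ = L * d := mul_one _
      rw [sub_sub_cancel, abs_of_pos hp] at h
      linarith

end AFM

/-! ### Existence and convergence -/

namespace AFM

variable {nr no nc nzo nzc : ℕ} {S : AFM nr no nc nzo nzc} {εbar Nmin : ℝ}
  {M : EuclideanSpace ℝ (Fin nr) → ℝ → ℝ → State no nc nzo nzc}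
  {εstar : EuclideanSpace ℝ (Fin nr) → ℝ → ℝ → ℝ} {a ω δ N : ℝ} {ξ₀ : EuclideanSpace ℝ (Fin nr)}
  {R c ρx0 ρε0 νεp : ℝ} {φx : ℝ → State no nc nzo nzc} {φε : ℝ → ℝ}

theorem histLength_pos (hT : 0 < S.Tl) (hω : 0 < ω) : 0 < S.histLength ω := by
  unfold histLength; positivity

/-- A path that continues an admissible history, satisfies the closed-loop equations and stays in
the trapping region on `[0, T]`, is a trapped run. -/
theorem IsAdmissibleHistory.trappedRun
    (hadm : S.IsAdmissibleHistory εbar εstar a ω N ξ₀ ρx0 ρε0 νεp φx φε) (hT : 0 < S.Tl)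
    (hN : Nmin < N) (hξ : ξ₀ ∈ S.Dr) (ha : 0 < a) (hω : 0 < ω) (hδ : 0 < δ) (hc : 0 < c)
    (hR : ρx0 ≤ R) (hstar : Continuous fun τ => εstar ξ₀ N τ)
    {xt : ℝ → State no nc nzo nzc} {εt : ℝ → ℝ} {T : ℝ} (hT0 : 0 ≤ T)
    (hx : EqOn xt φx (Icc (-S.histLength ω) 0)) (hε : EqOn εt φε (Icc (-S.histLength ω) 0))
    (hreg : ∀ τ ∈ Icc 0 T, ‖xt τ‖ ≤ R ∧ scanRate εstar ξ₀ a ω N εt τ ∈ Icc c (εbar - c))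
    (hdx : ∀ τ ∈ Icc 0 T, HasDerivWithinAt xt
      (S.fTilde M (xt τ) (S.exo N ξ₀ τ) (scanRate εstar ξ₀ a ω N εt τ) N
        - (S.adaptation M ξ₀ a ω δ N xt (scanRate εstar ξ₀ a ω N εt) τ
            + a * ω * Real.cos (ω * τ)) •
          derivWithin (fun e => M (S.exo N ξ₀ τ) e N) (Ioc 0 εbar)
            (scanRate εstar ξ₀ a ω N εt τ)) (Icc 0 T) τ)
    (hdε : ∀ τ ∈ Icc 0 T, HasDerivWithinAt (estimate εstar ξ₀ N εt)
      (S.adaptation M ξ₀ a ω δ N xt (scanRate εstar ξ₀ a ω N εt) τ) (Icc 0 T) τ) :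
    TrappedRun S εbar Nmin M εstar a ω δ N ξ₀ R c T xt εt := by
  have hh := histLength_pos hT hω
  have hun : Icc (-S.histLength ω) T = Icc (-S.histLength ω) 0 ∪ Icc 0 T :=
    (Icc_union_Icc_eq_Icc (by linarith) hT0).symm
  have hsc : EqOn (scanRate εstar ξ₀ a ω N εt) (scanRate εstar ξ₀ a ω N φε)
      (Icc (-S.histLength ω) 0) := fun τ hτ => by
    simp only [scanRate, estimate, hε hτ]
  refine ⟨hN, hξ, ha, hω, hδ, ?_, ?_, ?_, ?_, fun τ hτ => (hreg τ hτ).2, hdx, hdε⟩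
  · rw [hun]
    exact (hadm.continuous_x.congr hx).union_of_isClosed
      (fun τ hτ => (hdx τ hτ).continuousWithinAt) isClosed_Icc isClosed_Icc
  · rw [hun]
    refine ContinuousOn.union_of_isClosed ?_ ?_ isClosed_Icc isClosed_Icc
    · refine ContinuousOn.congr ?_ hsc
      exact (hadm.continuous_ε.add hstar.continuousOn).add (by fun_prop)
    · exact ContinuousOn.add (fun τ hτ => (hdε τ hτ).continuousWithinAt) (by fun_prop)
  · rw [hun]
    rintro τ (hτ | hτ)
    · rw [hx hτ]; exact (hadm.bound_x τ hτ).trans hR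
    · exact (hreg τ hτ).1
  · rw [hun]
    rintro τ (hτ | hτ)
    · rw [hsc hτ]; exact hadm.range τ hτ
    · have h := (hreg τ hτ).2
      exact ⟨hc.trans_le h.1, by linarith [h.2]⟩

/-- The trapping region is never left, if runs in it satisfy its inequalities strictly. The state is
monitored through a continuous function `w` that agrees with it as long as the scan rate keeps its
margin. -/
theorem forall_mem_region {xt w : ℝ → State no nc nzo nzc} {ε : ℝ → ℝ}
    (hw : ContinuousOn w (Ici 0)) (hε : ContinuousOn ε (Ici 0))
    (hwx : ∀ τ, 0 ≤ τ → ε τ ∈ Icc c (εbar - c) → w τ = xt τ)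
    (h0 : ‖xt 0‖ < R) (h0' : ε 0 ∈ Ioo c (εbar - c))
    (hstrict : ∀ T, 0 ≤ T → (∀ τ ∈ Icc 0 T, ‖xt τ‖ ≤ R ∧ ε τ ∈ Icc c (εbar - c)) →
      ‖xt T‖ < R ∧ ε T ∈ Ioo c (εbar - c)) :
    ∀ τ, 0 ≤ τ → ‖xt τ‖ ≤ R ∧ ε τ ∈ Icc c (εbar - c) := by
  have key := neg_of_forall_nonpos_imp_neg
    (g := fun τ => max (‖w τ‖ - R) (max (ε τ - (εbar - c)) (c - ε τ))) (by fun_prop) ?_ ?_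
  · intro τ hτ
    have h := key τ hτ
    simp only [max_lt_iff] at h
    have hm : ε τ ∈ Icc c (εbar - c) := ⟨by linarith [h.2.2], by linarith [h.2.1]⟩
    rw [← hwx τ hτ hm]
    exact ⟨by linarith [h.1], hm⟩
  · simp only [max_lt_iff]
    rw [hwx 0 le_rfl (Ioo_subset_Icc_self h0')]
    exact ⟨by linarith, by linarith [h0'.2], by linarith [h0'.1]⟩
  · intro T hT hle
    have hreg : ∀ τ ∈ Icc 0 T, ‖xt τ‖ ≤ R ∧ ε τ ∈ Icc c (εbar - c) := fun τ hτ => by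
      have h := hle τ hτ
      simp only [max_le_iff] at h
      have hm : ε τ ∈ Icc c (εbar - c) := ⟨by linarith [h.2.2], by linarith [h.2.1]⟩
      rw [← hwx τ hτ.1 hm]
      exact ⟨by linarith [h.1], hm⟩
    have h := hstrict T hT hreg
    simp only [max_lt_iff]
    rw [hwx T hT (hreg T ⟨hT, le_rfl⟩).2]
    exact ⟨by linarith [h.1], by linarith [h.2.2], by linarith [h.2.1]⟩

/-- As long as the run stays in the trapping region the cutoffs are inactive, and the run of the
cut-off system satisfies the closed-loop equations. -/
theorem closedLoop_of_cutoff (hreg : S.Regular εbar Nmin)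
    (hss : S.SteadyStateAssumption εbar Nmin M) (hexo : S.ExosystemAssumption Nmin)
    (hN : Nmin ≤ N) (hξ : ξ₀ ∈ S.Dr) (hω : 0 < ω)
    {K B : ℝ} (hK : 0 < K) (hB : ∀ ξ ∈ S.Dr, ∀ ε ∈ Ioc 0 εbar, ‖M ξ ε N‖ ≤ B) (hRK : R + B ≤ K)
    {y : ℝ → State no nc nzo nzc × ℝ} {xt : ℝ → State no nc nzo nzc} {ε : ℝ → ℝ} {T : ℝ}
    (hyε : ∀ τ, ε τ = (y τ).2 + a * Real.sin (ω * τ))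
    (hyx : ∀ τ, xt τ = (y τ).1 - M (S.exo N ξ₀ τ) (ε τ) N)
    (hx : ∀ τ ∈ Icc (-S.histLength ω) T, ‖xt τ‖ ≤ R ∧ ε τ ∈ Ioc 0 εbar)
    (hm : ∀ τ ∈ Icc 0 T, ε τ ∈ Icc c (εbar - c))
    (hy : ∀ t ∈ Icc 0 T, HasDerivWithinAt y (S.cutoffField K c εbar a ω δ N ξ₀ t y) (Icc 0 T) t) :
    ∀ τ ∈ Icc 0 T,
      HasDerivWithinAt xt
        (S.fTilde M (xt τ) (S.exo N ξ₀ τ) (ε τ) N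
          - (S.adaptation M ξ₀ a ω δ N xt ε τ + a * ω * Real.cos (ω * τ)) •
            derivWithin (fun e => M (S.exo N ξ₀ τ) e N) (Ioc 0 εbar) (ε τ)) (Icc 0 T) τ ∧
      HasDerivWithinAt (fun t => (y t).2) (S.adaptation M ξ₀ a ω δ N xt ε τ) (Icc 0 T) τ := by
  have hh := histLength_pos hreg.Tl_pos hω
  have hper : 0 < 2 * Real.pi / ω := by positivity
  have hhl : S.histLength ω = S.Tl + 2 * Real.pi / ω := rfl
  have hsub : Icc 0 T ⊆ Icc (-S.histLength ω) T := Icc_subset_Icc_left (by linarith)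
  have hy1 : ∀ τ, (y τ).1 = xt τ + M (S.exo N ξ₀ τ) (ε τ) N := fun τ => by
    rw [hyx]; abel
  have hret : ∀ τ ∈ Icc (-S.histLength ω) T, radialRetraction K (y τ).1 = (y τ).1 := by
    intro τ hτ
    refine radialRetraction_of_norm_le hK ?_
    rw [hy1]
    exact (norm_add_le _ _).trans ((add_le_add (hx τ hτ).1
      (hB _ (hexo.invariant N hN ξ₀ hξ τ) _ (hx τ hτ).2)).trans hRK)
  have hperf : ∀ σ ∈ Icc (-(2 * Real.pi / ω)) T,
      S.cutoffPerformance K εbar a ω y σ = S.performance M ξ₀ N xt ε σ := by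
    intro σ hσ
    have hw : ∀ s ∈ Icc (σ - S.Tl) σ, s ∈ Icc (-S.histLength ω) T := fun s hs =>
      ⟨by rw [hhl]; linarith [hs.1, hσ.1], hs.2.trans hσ.2⟩
    unfold cutoffPerformance performance
    rw [← hyε, clamp_of_mem (Ioc_subset_Icc_self (hx _ (hw _ (delayed_mem hreg σ))).2)]
    congr 2
    refine S.lineError_congr hreg.Tl_pos fun s hs => ?_
    rw [hret s (hw s hs), hy1]
  intro τ hτ
  have hfield : S.cutoffField K c εbar a ω δ N ξ₀ τ y
      = (S.f (xt τ + M (S.exo N ξ₀ τ) (ε τ) N) (S.exo N ξ₀ τ) (ε τ) N,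
        S.adaptation M ξ₀ a ω δ N xt ε τ) := by
    unfold cutoffField adaptation
    rw [hret τ (hsub hτ), ← hyε, clamp_of_mem (hm τ hτ), ← hy1]
    congr 2
    refine intervalIntegral.integral_congr fun σ hσ => ?_
    rw [uIcc_of_le (by linarith)] at hσ
    rw [hperf σ ⟨by linarith [hσ.1, hτ.1], hσ.2.trans hτ.2⟩]
  have hd := hy τ hτ
  rw [hfield] at hd
  have hd2 : HasDerivWithinAt (fun t => (y t).2) (S.adaptation M ξ₀ a ω δ N xt ε τ) (Icc 0 T) τ :=
    hd.snd
  refine ⟨?_, hd2⟩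
  have hsin : HasDerivAt (fun τ => a * Real.sin (ω * τ)) (a * ω * Real.cos (ω * τ)) τ :=
    (((hasDerivAt_id' τ).const_mul ω).sin.const_mul a).congr_deriv (by ring)
  have hdε : HasDerivWithinAt ε (S.adaptation M ξ₀ a ω δ N xt ε τ + a * ω * Real.cos (ω * τ))
      (Icc 0 T) τ :=
    (hd2.add hsin.hasDerivWithinAt).congr (fun s _ => hyε s) (hyε τ)
  have hpath := hss.hasDerivWithinAt_path hexo hN hξ (U := Icc 0 T)
    (fun s hs => (hx s (hsub hs)).2) hτ hdε
  have hd1 : HasDerivWithinAt (fun t => (y t).1)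
      (S.f (xt τ + M (S.exo N ξ₀ τ) (ε τ) N) (S.exo N ξ₀ τ) (ε τ) N) (Icc 0 T) τ := hd.fst
  have hdiff := (hd1.sub hpath).congr (fun s _ => hyx s) (hyx τ)
  rwa [← sub_sub] at hdiff

/-- Existence for the closed loop, given that runs in the trapping region satisfy its inequalities
strictly: a solution of the cut-off system never feels the cutoffs. -/
theorem exists_closedLoopSolution (hεbar : 0 < εbar) (hreg : S.Regular εbar Nmin)
    (hexo : S.ExosystemAssumption Nmin) (htop : S.TopographyAssumption)
    (hss : S.SteadyStateAssumption εbar Nmin M) (hstar : ContDiff ℝ 1 fun τ => εstar ξ₀ N τ)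
    (hN : Nmin < N) (hξ : ξ₀ ∈ S.Dr) (ha : 0 < a) (hω : 0 < ω) (hδ : 0 < δ)
    (hρx0 : 0 < ρx0) (hR : ρx0 < R) (hc : 0 < c) (hcν : c < νεp) (hνεp : νεp < εbar / 2)
    (hadm : S.IsAdmissibleHistory εbar εstar a ω N ξ₀ ρx0 ρε0 νεp φx φε)
    (hgain : ∀ (T : ℝ) (xt : ℝ → State no nc nzo nzc) (εt : ℝ → ℝ),
      TrappedRun S εbar Nmin M εstar a ω δ N ξ₀ R c T xt εt → ‖xt 0‖ ≤ ρx0 →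
      estimate εstar ξ₀ N εt 0 ∈ Icc νεp (εbar - νεp) → 0 ≤ T →
      ‖xt T‖ < R ∧ scanRate εstar ξ₀ a ω N εt T ∈ Ioo c (εbar - c)) :
    ∃ xt εt, S.IsClosedLoopSolution εbar M εstar a ω δ N ξ₀ φx φε xt εt := by
  have hh := histLength_pos hreg.Tl_pos hω
  have hle : -S.histLength ω ≤ 0 := by linarith
  obtain ⟨B₀, hB₀⟩ := hss.bounded
  obtain ⟨B, hBpos, hB⟩ : ∃ B, 0 ≤ B ∧ ∀ ξ ∈ S.Dr, ∀ ε ∈ Ioc 0 εbar, ‖M ξ ε N‖ ≤ B :=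
    ⟨|B₀|, abs_nonneg _, fun ξ hξ ε hε => (hB₀ N hN.le ξ hξ ε hε).trans (le_abs_self _)⟩
  -- the history in the variables plant state and estimate, continued by constants
  have hφε : ContinuousOn (scanRate εstar ξ₀ a ω N φε) (Icc (-S.histLength ω) 0) :=
    (hadm.continuous_ε.add hstar.continuous.continuousOn).add (by fun_prop)
  have hψc : ContinuousOn (fun τ => (φx τ + M (S.exo N ξ₀ τ) (scanRate εstar ξ₀ a ω N φε τ) N,
      estimate εstar ξ₀ N φε τ)) (Icc (-S.histLength ω) 0) :=
    (hadm.continuous_x.add (hss.continuousOn_path hexo hN.le hξ hφε hadm.range)).prodMk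
      (hadm.continuous_ε.add hstar.continuous.continuousOn)
  have hψ := (continuousOn_iff_continuous_domRestrict.1 hψc).Icc_extend' (h := hle)
  obtain ⟨y, hyc, hy0, hyd⟩ := exists_cutoffField_solution hreg htop hexo hεbar
    (K := R + B) (c := c) (by linarith) hc (by linarith) ha hω hδ hN.le ξ₀ hψ
  have hyhist : ∀ τ ∈ Icc (-S.histLength ω) 0,
      y τ = (φx τ + M (S.exo N ξ₀ τ) (scanRate εstar ξ₀ a ω N φε τ) N,
        estimate εstar ξ₀ N φε τ) := fun τ hτ => by
    rw [hy0 τ hτ.2, IccExtend_of_mem hle _ hτ]; rfl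
  let εt : ℝ → ℝ := fun τ => (y τ).2 - εstar ξ₀ N τ
  have hest : estimate εstar ξ₀ N εt = fun τ => (y τ).2 := by
    funext τ; simp only [estimate, εt]; ring
  set ε := scanRate εstar ξ₀ a ω N εt with hε
  have hyε : ∀ τ, ε τ = (y τ).2 + a * Real.sin (ω * τ) := fun τ => by
    rw [hε, scanRate, hest]
  have hεc : Continuous ε := by
    have : ε = fun τ => (y τ).2 + a * Real.sin (ω * τ) := funext hyε
    rw [this]; fun_prop
  let xt : ℝ → State no nc nzo nzc := fun τ => (y τ).1 - M (S.exo N ξ₀ τ) (ε τ) N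
  have hεhist : ∀ τ ∈ Icc (-S.histLength ω) 0, ε τ = scanRate εstar ξ₀ a ω N φε τ :=
    fun τ hτ => by rw [hyε, hyhist τ hτ]; rfl
  have hxhist : EqOn xt φx (Icc (-S.histLength ω) 0) := fun τ hτ => by
    simp only [xt]
    rw [hεhist τ hτ, hyhist τ hτ, add_sub_cancel_right]
  have hεthist : EqOn εt φε (Icc (-S.histLength ω) 0) := fun τ hτ => by
    simp only [εt, hyhist τ hτ, estimate, add_sub_cancel_right]
  have hzero : (0 : ℝ) ∈ Icc (-S.histLength ω) 0 := ⟨hle, le_rfl⟩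
  have hx0 : ‖xt 0‖ ≤ ρx0 := by rw [hxhist hzero]; exact hadm.bound_x 0 hzero
  have he0 : estimate εstar ξ₀ N εt 0 ∈ Icc νεp (εbar - νεp) := by
    have : estimate εstar ξ₀ N εt 0 = estimate εstar ξ₀ N φε 0 := by
      simp only [estimate, hεthist hzero]
    rw [this]; exact hadm.margin
  have hloop : ∀ T, 0 ≤ T → (∀ τ ∈ Icc 0 T, ‖xt τ‖ ≤ R ∧ ε τ ∈ Icc c (εbar - c)) →
      ∀ τ ∈ Icc 0 T,
        HasDerivWithinAt xt
          (S.fTilde M (xt τ) (S.exo N ξ₀ τ) (ε τ) N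
            - (S.adaptation M ξ₀ a ω δ N xt ε τ + a * ω * Real.cos (ω * τ)) •
              derivWithin (fun e => M (S.exo N ξ₀ τ) e N) (Ioc 0 εbar) (ε τ)) (Icc 0 T) τ ∧
        HasDerivWithinAt (fun t => (y t).2) (S.adaptation M ξ₀ a ω δ N xt ε τ) (Icc 0 T) τ := by
    intro T hT hr
    refine closedLoop_of_cutoff hreg hss hexo hN.le hξ hω (K := R + B) (by linarith) hB le_rfl
      hyε (fun τ => rfl) (fun τ hτ => ?_) (fun τ hτ => (hr τ hτ).2)
      (fun t ht => (hyd t ht.1).mono Icc_subset_Ici_self)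
    rcases le_or_gt τ 0 with h | h
    · have hτ' : τ ∈ Icc (-S.histLength ω) 0 := ⟨hτ.1, h⟩
      rw [hxhist hτ', hεhist τ hτ']
      exact ⟨(hadm.bound_x τ hτ').trans hR.le, hadm.range τ hτ'⟩
    · have h1 := hr τ ⟨h.le, hτ.2⟩
      exact ⟨h1.1, hc.trans_le h1.2.1, by linarith [h1.2.2]⟩
  have hregion := forall_mem_region (xt := xt) (ε := ε) (R := R) (c := c) (εbar := εbar)
    (w := fun τ => (y τ).1 - M (S.exo N ξ₀ τ) (clamp c (εbar - c) (ε τ)) N)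
    (hyc.fst.continuousOn.sub (hss.continuousOn_path hexo hN.le hξ
      ((continuous_clamp _ _).comp hεc).continuousOn fun s _ => by
        have h1 := clamp_mem (c := c) (d := εbar - c) (by linarith) (ε s)
        exact ⟨hc.trans_le h1.1, h1.2.trans (by linarith)⟩))
    hεc.continuousOn (fun τ _ hτ => by simp only [xt, clamp_of_mem hτ])
    (hx0.trans_lt hR)
    (by
      have h1 : ε 0 = estimate εstar ξ₀ N εt 0 := by rw [hε, scanRate]; simp
      rw [h1]; exact ⟨by linarith [he0.1], by linarith [he0.2]⟩)
    (fun T hT hr => hgain T xt εt (hadm.trappedRun hreg.Tl_pos hN hξ ha hω hδ hc hR.le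
      hstar.continuous hT hxhist hεthist hr (fun τ hτ => (hloop T hT hr τ hτ).1)
      (fun τ hτ => by rw [hest]; exact (hloop T hT hr τ hτ).2)) hx0 he0 hT)
  have hfinal : ∀ τ ∈ Ici (0 : ℝ), Icc 0 (τ + 1) ∈ 𝓝[Ici 0] τ := fun τ hτ => by
    have : Icc 0 (τ + 1) = Ici 0 ∩ Iic (τ + 1) := rfl
    rw [this]
    exact inter_mem_nhdsWithin _ (Iic_mem_nhds (by linarith))
  have hall : ∀ τ ∈ Ici (0 : ℝ), _ := fun τ hτ => hloop (τ + 1) (by linarith [mem_Ici.1 hτ])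
    (fun s hs => hregion s hs.1) τ ⟨hτ, by linarith⟩
  refine ⟨xt, εt, hxhist, hεthist, fun τ hτ => (hall τ hτ).1.mono_of_mem_nhdsWithin (hfinal τ hτ),
    fun τ hτ => ?_⟩
  have h1 := (hall τ hτ).2.mono_of_mem_nhdsWithin (hfinal τ hτ)
  exact h1.sub ((hstar.differentiable (by norm_num)) τ).hasDerivAt.hasDerivWithinAt

/-- Solutions of the closed loop never leave the trapping region. -/
theorem IsClosedLoopSolution.trappedRun {xt : ℝ → State no nc nzo nzc} {εt : ℝ → ℝ}
    (hsol : S.IsClosedLoopSolution εbar M εstar a ω δ N ξ₀ φx φε xt εt)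
    (hreg : S.Regular εbar Nmin) (hstar : ContDiff ℝ 1 fun τ => εstar ξ₀ N τ)
    (hN : Nmin < N) (hξ : ξ₀ ∈ S.Dr) (ha : 0 < a) (hω : 0 < ω) (hδ : 0 < δ)
    (hR : ρx0 < R) (hc : 0 < c) (hcν : c < νεp)
    (hadm : S.IsAdmissibleHistory εbar εstar a ω N ξ₀ ρx0 ρε0 νεp φx φε)
    (hgain : ∀ (T : ℝ) (xt : ℝ → State no nc nzo nzc) (εt : ℝ → ℝ),
      TrappedRun S εbar Nmin M εstar a ω δ N ξ₀ R c T xt εt → ‖xt 0‖ ≤ ρx0 →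
      estimate εstar ξ₀ N εt 0 ∈ Icc νεp (εbar - νεp) → 0 ≤ T →
      ‖xt T‖ < R ∧ scanRate εstar ξ₀ a ω N εt T ∈ Ioo c (εbar - c)) :
    ‖xt 0‖ ≤ ρx0 ∧ estimate εstar ξ₀ N εt 0 ∈ Icc νεp (εbar - νεp) ∧
      ∀ T, 0 ≤ T → TrappedRun S εbar Nmin M εstar a ω δ N ξ₀ R c T xt εt := by
  have hh := histLength_pos hreg.Tl_pos hω
  have hzero : (0 : ℝ) ∈ Icc (-S.histLength ω) 0 := ⟨by linarith, le_rfl⟩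
  have hx0 : ‖xt 0‖ ≤ ρx0 := by rw [hsol.history_x hzero]; exact hadm.bound_x 0 hzero
  have he0 : estimate εstar ξ₀ N εt 0 ∈ Icc νεp (εbar - νεp) := by
    have : estimate εstar ξ₀ N εt 0 = estimate εstar ξ₀ N φε 0 := by
      simp only [estimate, hsol.history_ε hzero]
    rw [this]; exact hadm.margin
  have hest : ∀ τ ∈ Ici (0 : ℝ), HasDerivWithinAt (estimate εstar ξ₀ N εt)
      (S.adaptation M ξ₀ a ω δ N xt (scanRate εstar ξ₀ a ω N εt) τ) (Ici 0) τ := fun τ hτ => by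
    have h := (hsol.deriv_ε τ hτ).add
      ((hstar.differentiable (by norm_num)) τ).hasDerivAt.hasDerivWithinAt
    rw [sub_add_cancel] at h
    exact h
  have hrun : ∀ T, 0 ≤ T → (∀ τ ∈ Icc 0 T, ‖xt τ‖ ≤ R ∧
      scanRate εstar ξ₀ a ω N εt τ ∈ Icc c (εbar - c)) →
      TrappedRun S εbar Nmin M εstar a ω δ N ξ₀ R c T xt εt := fun T hT hr =>
    hadm.trappedRun hreg.Tl_pos hN hξ ha hω hδ hc hR.le hstar.continuous hT hsol.history_x
      hsol.history_ε hr (fun τ hτ => (hsol.deriv_x τ hτ.1).mono Icc_subset_Ici_self)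
      (fun τ hτ => (hest τ hτ.1).mono Icc_subset_Ici_self)
  have hregion := forall_mem_region (xt := xt) (w := xt) (ε := scanRate εstar ξ₀ a ω N εt)
    (R := R) (c := c) (εbar := εbar)
    (fun τ hτ => (hsol.deriv_x τ hτ).continuousWithinAt)
    (ContinuousOn.add (fun τ hτ => (hest τ hτ).continuousWithinAt) (by fun_prop))
    (fun _ _ _ => rfl) (hx0.trans_lt hR)
    (by
      have h1 : scanRate εstar ξ₀ a ω N εt 0 = estimate εstar ξ₀ N εt 0 := by simp [scanRate]
      rw [h1]; exact ⟨by linarith [he0.1], by linarith [he0.2]⟩)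
    (fun T hT hr => hgain T xt εt (hrun T hT hr) hx0 he0 hT)
  exact ⟨hx0, he0, fun T hT => hrun T hT fun τ hτ => hregion τ hτ.1⟩

end AFM

theorem theorem1 {nr no nc nzo nzc : ℕ} (S : AFM nr no nc nzo nzc)
    (εbar Nmin : ℝ) (hεbar : 0 < εbar) (hNmin : 0 < Nmin)
    (M : EuclideanSpace ℝ (Fin nr) → ℝ → ℝ → AFM.State no nc nzo nzc)
    (εstar : EuclideanSpace ℝ (Fin nr) → ℝ → ℝ → ℝ)
    (hreg : S.Regular εbar Nmin)
    (hexo : S.ExosystemAssumption Nmin)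
    (htop : S.TopographyAssumption)
    (hss : S.SteadyStateAssumption εbar Nmin M)
    (hcost : S.CostAssumption εbar Nmin M εstar)
    (hslow : S.SlowVariationAssumption εbar Nmin M εstar)
    (ρx0 ρε0 : ℝ) (hρx0 : 0 < ρx0) (hρε0 : 0 < ρε0)
    (νεp : ℝ) (hνεp : νεp ∈ Set.Ioo 0 (εbar / 2))
    (νx νε : ℝ) (hνx : 0 < νx) (hνε : 0 < νε) :
    ∃ ρx > 0, ∃ ρε > 0, ∃ astar > 0, ∀ a ∈ Set.Ioo 0 astar,
    ∃ ωstar > 0, ∀ ω ∈ Set.Ioo 0 ωstar,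
    ∃ δstar > 0, ∀ δ ∈ Set.Ioo 0 δstar,
    ∃ Nstar > 0, ∀ N ∈ Set.Ioi Nstar,
    ∀ ξ₀ ∈ S.Dr, ∀ (φx : ℝ → AFM.State no nc nzo nzc) (φε : ℝ → ℝ),
      S.IsAdmissibleHistory εbar εstar a ω N ξ₀ ρx0 ρε0 νεp φx φε →
      (∃ xt εt, S.IsClosedLoopSolution εbar M εstar a ω δ N ξ₀ φx φε xt εt) ∧
      ∀ xt εt, S.IsClosedLoopSolution εbar M εstar a ω δ N ξ₀ φx φε xt εt →
        (∀ τ, 0 ≤ τ → ‖xt τ‖ ≤ ρx ∧ |εt τ| ≤ ρε) ∧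
        Filter.limsup (fun τ => ‖xt τ‖) Filter.atTop ≤ νx ∧
        Filter.limsup (fun τ => |εt τ|) Filter.atTop ≤ νε ∧
        ∀ τ, 0 ≤ τ → 0 < AFM.scanRate εstar ξ₀ a ω N εt τ ∧
          AFM.scanRate εstar ξ₀ a ω N εt τ < εbar := by
  obtain ⟨R, hR, c, hc, hcν, astar, hastar, hgains⟩ := S.exists_gains hεbar hNmin hreg hexo htop
    hss hcost hslow hρx0 hνεp hνx hνε
  refine ⟨R, hρx0.trans hR, εbar, hεbar, astar, hastar, fun a ha => ?_⟩
  obtain ⟨ωstar, hωstar, hgains⟩ := hgains a ha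
  refine ⟨ωstar, hωstar, fun ω hω => ?_⟩
  obtain ⟨δstar, hδstar, hgains⟩ := hgains ω hω
  refine ⟨δstar, hδstar, fun δ hδ => ?_⟩
  obtain ⟨Nstar, hNstar, hNle, hgains⟩ := hgains δ hδ
  refine ⟨Nstar, hNstar, fun N hN ξ₀ hξ φx φε hadm => ?_⟩
  obtain ⟨T₁, hgains⟩ := hgains N hN
  have hNN : Nmin < N := hNle.trans_lt hN
  have hstar := hslow.star_smooth N hNN.le ξ₀ hξ
  have hstrict := fun (T : ℝ) xt εt
      (h : AFM.TrappedRun S εbar Nmin M εstar a ω δ N ξ₀ R c T xt εt) h1 h2 (hT : 0 ≤ T) =>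
    And.intro (hgains ξ₀ T xt εt h h1 h2 T ⟨hT, le_rfl⟩).1
      (hgains ξ₀ T xt εt h h1 h2 T ⟨hT, le_rfl⟩).2.1
  refine ⟨AFM.exists_closedLoopSolution hεbar hreg hexo htop hss hstar hNN hξ ha.1 hω.1 hδ.1 hρx0
    hR hc hcν hνεp.2 hadm hstrict, fun xt εt hsol => ?_⟩
  obtain ⟨hx0, he0, hrun⟩ := hsol.trappedRun hreg hstar hNN hξ ha.1 hω.1 hδ.1 hR hc hcν hadm hstrict
  have hest := fun τ (hτ : 0 ≤ τ) => hgains ξ₀ τ xt εt (hrun τ hτ) hx0 he0 τ ⟨hτ, le_rfl⟩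
  have hlim : ∀ᶠ τ in atTop, ‖xt τ‖ ≤ νx ∧ |εt τ| ≤ νε := by
    filter_upwards [eventually_ge_atTop 0, eventually_ge_atTop T₁] with τ h0 h1
    exact (hest τ h0).2.2.2 h1
  refine ⟨fun τ hτ => ⟨(hest τ hτ).1.le, (hest τ hτ).2.2.1⟩, ?_, ?_, fun τ hτ => ?_⟩
  · exact limsup_le_of_le (isCoboundedUnder_le_of_le atTop fun τ => norm_nonneg (xt τ))
      (hlim.mono fun _ h => h.1)
  · exact limsup_le_of_le (isCoboundedUnder_le_of_le atTop fun τ => abs_nonneg (εt τ))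
      (hlim.mono fun _ h => h.2)
  · have h := (hest τ hτ).2.1
    exact ⟨hc.trans h.1, by linarith [h.2]⟩
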